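/- Let $\phi=\frac{1+\sqrt5}{2}$. The double pentagon is the translation surface obtained from a regular pentagon $P$ with side $1$ and horizontal diagonal and its image $P'=-P$ under a central symmetry by gluing parallel sides by translations. A direction (up to sign) of slope $\lambda$ is given the coordinate $x=\frac{\sin 36^\circ}{\lambda}\in\mathbb R\cup\{\infty\}$, so that the directions of the diagonals of $P$ are $1-\frac\phi2,\frac\phi2,\infty,-\frac\phi2,\frac\phi2-1$. Put $$\alpha=1-\frac{\phi}{2},\qquad T(x)=\frac{2\phi x+3-\phi}{2\phi-4x},\qquad R(x)=\frac{1}{4\phi^4x},$$ and for $k\ge 0$ and $n_1,\dots,n_k\in\{0,1,2,3\}$ with $n_k\neq 0$ (if $k\ge1$) let $$\alpha_{n_1n_2\dots n_k}=RT^{m_1}RT^{m_2}\cdots RT^{m_k}\alpha,\qquad m_i=\begin{cases}4-n_i,& i\text{ even},\\ n_i+1,& i\text{ odd},\ i\ne k,\\ n_i,& i\text{ odd},\ i=k.\end{cases}$$ In the direction $\alpha_{n_1\dots n_k}$ all linear trajectories on the double pentagon that avoid the vertices are closed and form two strips of parallel periodic trajectories. Let $a\le A$ be the periods of the trajectories of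 the two strips, where the period of a trajectory is the period of its symbolic orbit in the four-interval exchange induced on the horizontal diagonal of $P$; equivalently, it is half of the period of the sequence of the sides (labelled by five symbols, glued sides having the same label) that the trajectory crosses. Then the encoded period $a+\phi A\in\mathbb Z[\phi]$ is the first component of the vector $$X_{n_k}X_{n_{k-1}}\cdots X_{n_1}\begin{pmatrix}\phi^2\\ \phi^2\end{pmatrix},$$ where $$X_0=\begin{pmatrix}1&0\\ \phi&1\end{pmatrix},\quad X_1=\begin{pmatrix}\phi&1\\ \phi&\phi\end{pmatrix},\quad X_2=\begin{pmatrix}\phi&\phi\\ 1&\phi\end{pmatrix},\quad X_3=\begin{pmatrix}1&\phi\\ 0&1\end{pmatrix}.$$ -/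

import Mathlib

open scoped goldenRatio Matrix OnePoint

noncomputable section

namespace DoublePentagon

/-! ### The double pentagon and its linear trajectories -/

/-- Vertices, in counterclockwise order, of the regular pentagon `P` with side length `1` whose
horizontal diagonal (of length `φ`) joins `(0, 0)` to `(φ, 0)` and whose apex lies above it. -/
def vertex : Fin 5 → ℝ × ℝ :=
  ![(0, 0),
    ((φ - 1) / 2, -(φ * Real.sin (Real.pi / 5))),
    ((φ + 1) / 2, -(φ * Real.sin (Real.pi / 5))),
    (φ, 0),
    (φ / 2, Real.sin (Real.pi / 5))]

/-- The `j`-th side of `P` without its end points. The second pentagon is `P' = -P`, and its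
`j`-th side is `-(side j)`. -/
def side (j : Fin 5) : Set (ℝ × ℝ) := openSegment ℝ (vertex j) (vertex (j + 1))

/-- The double pentagon is obtained from `P` and `P' = -P` by gluing the `j`-th side of `P` to the
(parallel) `j`-th side of `P'` by the translation `p ↦ p - shift j`; this map sends `vertex j` to
`-vertex (j + 1)` and `vertex (j + 1)` to `-vertex j`. -/
def shift (j : Fin 5) : ℝ × ℝ := vertex j + vertex (j + 1)

/-- `1` for even `n`, `-1` for odd `n`. -/
def sgn (n : ℤ) : ℝ := if Even n then 1 else -1

/-- A (bi-infinite) linear trajectory of direction `d` on the double pentagon that avoids the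
vertices, recorded by its consecutive crossings of the sides. The crossings with even number go
from `P` to `P'`, those with odd number from `P'` to `P`. -/
structure Trajectory (d : ℝ × ℝ) where
  /-- the label of the side that is crossed at the `n`-th crossing -/
  label : ℤ → Fin 5
  /-- the `n`-th crossing point, as a boundary point of the pentagon which is left there:
  `P` for even `n` and `P' = -P` for odd `n` -/
  pt : ℤ → ℝ × ℝ
  pt_mem : ∀ n, sgn n • pt n ∈ side (label n)
  /-- After the `n`-th crossing the trajectory is in the other pentagon, at the point
  `pt n - sgn n • shift (label n)`, and follows the direction `d` to its next crossing point. -/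
  step : ∀ n, ∃ t : ℝ, 0 < t ∧ pt (n + 1) = pt n - sgn n • shift (label n) + t • d
  /-- The chord joins two different sides (it does not slide along a side). -/
  label_ne : ∀ n, label (n + 1) ≠ label n

namespace Trajectory

variable {d : ℝ × ℝ}

/-- The trajectory is periodic (closed). It has to be back in the same pentagon, so that the number
of crossings is even. -/
def IsClosed (τ : Trajectory d) : Prop :=
  ∃ q : ℕ, 0 < q ∧ ∀ n : ℤ, τ.label (n + 2 * q) = τ.label n ∧ τ.pt (n + 2 * q) = τ.pt n

/-- The symbolic orbit in the interval exchange alphabet. The section is the horizontal diagonal of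
`P`. A symbol is the pair of labels of the two sides crossed between two consecutive returns to the
section, first from `P` to `P'` and then from `P'` back to `P`; in the sector of directions
considered below there are exactly four such pairs, one for each of the four exchanged intervals. -/
def word (τ : Trajectory d) (m : ℤ) : Fin 5 × Fin 5 := (τ.label (2 * m), τ.label (2 * m + 1))

/-- `p` is the (combinatorial) period of the trajectory in the interval exchange alphabet: the
least period of its symbolic orbit. It is half of the period of the sequence of crossed sides. -/
def HasPeriod (τ : Trajectory d) (p : ℕ) : Prop :=
  IsLeast {q : ℕ | 0 < q ∧ ∀ m : ℤ, τ.word (m + q) = τ.word m} p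

/-- Two trajectories of the same direction have the same symbolic orbit up to a shift. For closed
trajectories this says that they belong to the same strip of parallel periodic trajectories. -/
def SameStrip (σ τ : Trajectory d) : Prop := ∃ k : ℤ, ∀ m : ℤ, σ.word (m + k) = τ.word m

end Trajectory

/-- The direction `d` is periodic, all trajectories of this direction form exactly two strips of
periodic trajectories, and `a ≤ A` are the periods of the trajectories of the two strips. -/
def IsPeriodPair (d : ℝ × ℝ) (a A : ℕ) : Prop :=
  a ≤ A ∧ (∀ ρ : Trajectory d, ρ.IsClosed) ∧
    ∃ σ τ : Trajectory d, σ.HasPeriod a ∧ τ.HasPeriod A ∧ ¬ σ.SameStrip τ ∧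
      ∀ ρ : Trajectory d, ρ.SameStrip σ ∨ ρ.SameStrip τ

/-! ### Directions -/

/-- The direction with the affine coordinate `x ∈ ℝ ∪ {∞}`: a line of slope `sin 36° / x`. The five
diagonals of the pentagon get the coordinates `1 - φ/2, φ/2, ∞, -φ/2, φ/2 - 1`. -/
def direction (x : OnePoint ℝ) : ℝ × ℝ := x.elim (1, 0) (fun u => (u, Real.sin (Real.pi / 5)))

lemma det_T : (!![2 * φ, 3 - φ; -4, 2 * φ] : Matrix (Fin 2) (Fin 2) ℝ).det ≠ 0 := by
  rw [Matrix.det_fin_two_of]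
  have h := Real.goldenRatio_sq
  nlinarith

lemma det_R : (!![0, 1; 4 * φ ^ 4, 0] : Matrix (Fin 2) (Fin 2) ℝ).det ≠ 0 := by
  rw [Matrix.det_fin_two_of]
  have h : 0 < φ ^ 4 := pow_pos Real.goldenRatio_pos 4
  linarith

/-- The rotation `T(x) = (2φx + 3 - φ) / (2φ - 4x)`, acting on `ℝ ∪ {∞}`. -/
def T : GL (Fin 2) ℝ := Matrix.GeneralLinearGroup.mkOfDetNeZero _ det_T

/-- The reflection `R(x) = 1 / (4φ⁴x)`, acting on `ℝ ∪ {∞}`. -/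
def R : GL (Fin 2) ℝ := Matrix.GeneralLinearGroup.mkOfDetNeZero _ det_R

/-- The exponents `m_1, …, m_k` of the direction with indices `n_1, …, n_k`. Here `i` is counted
from `0`, so that `i + 1` is the number of the index `n i`. -/
def exponent {k : ℕ} (n : Fin k → Fin 4) (i : Fin k) : ℕ :=
  if Even ((i : ℕ) + 1) then 4 - (n i : ℕ)
  else if (i : ℕ) + 1 = k then (n i : ℕ)
  else (n i : ℕ) + 1

/-- The point `α_{n_1 … n_k} = R T^{m_1} R T^{m_2} ⋯ R T^{m_k} α`, where `α = 1 - φ/2`. -/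
def alpha {k : ℕ} (n : Fin k → Fin 4) : OnePoint ℝ :=
  (List.ofFn fun i => R * T ^ exponent n i).prod • ((1 - φ / 2 : ℝ) : OnePoint ℝ)

/-! ### The matrices -/

/-- The matrices `X_0, X_1, X_2, X_3`, with entries in `ℤ[φ] ⊆ ℝ`. -/
def X : Fin 4 → Matrix (Fin 2) (Fin 2) ℝ :=
  ![!![1, 0; φ, 1], !![φ, 1; φ, φ], !![φ, φ; 1, φ], !![1, φ; 0, 1]]

end DoublePentagon

end

/-! In a direction of the sector, a chord of P runs from one of the three lower sides to one of the
two upper ones and so crosses the horizontal diagonal once; P' is P after a half-turn. Following the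
flow back to the diagonal gives an exchange of four intervals of lengths φy, x, y, φx, where x : y
are linear coordinates of the direction. Trajectories correspond to orbits that avoid the end points
(`IsSector.exists_trajectory`, `IsSector.exists_isOrbit`).

In these coordinates `T` and `R` act linearly, and R T^m for m = 1, ..., 4 acts on row vectors as
one of the matrices `X`, up to interchanging the two coordinates. The alternating exponents absorb
the interchange, so the direction with indices n has as coordinates the row (1, 0) X_{n_k} ⋯ X_{n_1}
(`alpha_eq_sectorPoint`).

The exchange for (x, y) X_m induces, on a subinterval, the exchange for (x, y)
(`goldenExchange_induces`). Removing all factors leaves a multiple of (1, 0), whose exchange fixes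
two intervals, of widths w and φw, and has no others of positive length. Substituting the return
words lifts these two cylinders back with the same widths (`Induces.isDecomposition`). Return words
have a unimodular count matrix, so letter counts stay coprime and word lengths are least periods.

For the coordinates w(r, s), the total length is w(a + φA) by the cylinders and w(1 + φ)(r + s) =
wφ²(r + s) by the intervals, which is the formula. Irrationality of φ also compares the letter
counts of the two words, whence a ≤ A and the strips differ (`exists_isStrip`). -/

noncomputable section

namespace DoublePentagon

/-! ### Interval exchanges and their cylinder decompositions -/

/-- A family of intervals `[lo i, hi i]`, each of which is translated by `t i`. -/
structure IntervalExchange (ι : Type*) where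
  lo : ι → ℝ
  hi : ι → ℝ
  t : ι → ℝ

namespace IntervalExchange

variable {ι κ : Type*}

/-- The total translation along a word. -/
def disp (F : IntervalExchange ι) (c : List ι) : ℝ := (c.map F.t).sum

/-- The interval `[p, p + w]` follows the word `c`. -/
def Fits (F : IntervalExchange ι) (w : ℝ) : ℝ → List ι → Prop
  | _, [] => True
  | p, i :: c => F.lo i ≤ p ∧ p + w ≤ F.hi i ∧ F.Fits w (p + F.t i) c

@[simp] lemma disp_nil (F : IntervalExchange ι) : F.disp [] = 0 := by simp [disp]

@[simp] lemma disp_cons (F : IntervalExchange ι) (i : ι) (c : List ι) :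
    F.disp (i :: c) = F.t i + F.disp c := by simp [disp]

@[simp] lemma disp_append (F : IntervalExchange ι) (u v : List ι) :
    F.disp (u ++ v) = F.disp u + F.disp v := by simp [disp]

lemma fits_append {F : IntervalExchange ι} {w : ℝ} {u v : List ι} : ∀ {p : ℝ},
    F.Fits w p (u ++ v) ↔ F.Fits w p u ∧ F.Fits w (p + F.disp u) v := by
  induction u with
  | nil => intro p; simp [Fits]
  | cons i u ih =>
    intro p
    simp only [List.cons_append, Fits, ih, disp_cons, and_assoc, add_assoc]

/-- The cylinder of width `w` that starts at `p` runs through the cyclic word `c`, which is not a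
proper power. -/
structure IsCylinder [DecidableEq ι] (F : IntervalExchange ι) (w p : ℝ) (c : List ι) : Prop where
  fits : F.Fits w p c
  disp_eq : F.disp c = 0
  primitive : ∀ k : ℕ, (∀ i, k ∣ c.count i) → k = 1

/-- The point `z` of the interval `i` lies in the closed cylinder. -/
def Meets (F : IntervalExchange ι) (w p : ℝ) (c : List ι) (i : ι) (z : ℝ) : Prop :=
  ∃ u v, c = u ++ i :: v ∧ p + F.disp u ≤ z ∧ z ≤ p + F.disp u + w

/-- The intervals are decomposed into two cylinders of widths `w₁` and `w₂`. -/
structure IsDecomposition [DecidableEq ι] (F : IntervalExchange ι) (w₁ w₂ p₁ : ℝ) (c₁ : List ι)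
    (p₂ : ℝ) (c₂ : List ι) : Prop where
  cyl₁ : F.IsCylinder w₁ p₁ c₁
  cyl₂ : F.IsCylinder w₂ p₂ c₂
  length_eq : ∀ i, F.hi i - F.lo i = w₁ * c₁.count i + w₂ * c₂.count i
  cover : ∀ i z, F.lo i < F.hi i → F.lo i ≤ z → z ≤ F.hi i →
    F.Meets w₁ p₁ c₁ i z ∨ F.Meets w₂ p₂ c₂ i z

/-- `G`, moved by `o`, is obtained from `F` by inducing on a subinterval: an interval `j` of `G`
follows the word `s j` in `F`. -/
structure Induces [DecidableEq ι] [Fintype κ] (F : IntervalExchange ι) (G : IntervalExchange κ)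
    (s : κ → List ι) (o : ℝ) : Prop where
  fits : ∀ j p w, 0 ≤ w → G.lo j ≤ p → p + w ≤ G.hi j → F.Fits w (p + o) (s j)
  disp_eq : ∀ j, F.disp (s j) = G.t j
  length_eq : ∀ i, F.hi i - F.lo i = ∑ j, (G.hi j - G.lo j) * (s j).count i
  primitive : ∀ (k : ℕ) (m : κ → ℕ), (∀ i, k ∣ ∑ j, m j * (s j).count i) → ∀ j, k ∣ m j
  cover : ∀ i z, F.lo i < F.hi i → F.lo i ≤ z → z ≤ F.hi i → ∃ j u v, s j = u ++ i :: v ∧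
    G.lo j < G.hi j ∧ G.lo j ≤ z - o - F.disp u ∧ z - o - F.disp u ≤ G.hi j

lemma count_flatMap_eq_sum [DecidableEq ι] [DecidableEq κ] [Fintype κ] (s : κ → List ι) (i : ι)
    (c : List κ) : (c.flatMap s).count i = ∑ j, c.count j * (s j).count i := by
  induction c with
  | nil => simp
  | cons a c ih =>
    simp [List.count_append, ih, List.count_cons, add_mul, Finset.sum_add_distrib, add_comm]

namespace Induces

variable [DecidableEq ι] [Fintype κ] {F : IntervalExchange ι}
  {G : IntervalExchange κ} {s : κ → List ι} {o : ℝ}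

lemma disp_flatMap (h : F.Induces G s o) (c : List κ) : F.disp (c.flatMap s) = G.disp c := by
  induction c with
  | nil => simp
  | cons a c ih => simp [ih, h.disp_eq]

lemma fits_flatMap (h : F.Induces G s o) {w : ℝ} (hw : 0 ≤ w) {c : List κ} : ∀ {p : ℝ},
    G.Fits w p c → F.Fits w (p + o) (c.flatMap s) := by
  induction c with
  | nil => intro p _; simp [Fits]
  | cons a c ih =>
    rintro p ⟨h1, h2, h3⟩
    rw [List.flatMap_cons, fits_append]
    refine ⟨h.fits a p w hw h1 h2, ?_⟩
    rw [h.disp_eq]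
    have := ih h3
    rwa [add_right_comm] at this

/-- Coprimality of the letter counts is the form of primitivity that survives substitution: the
counts change by the count matrix of `s`, and divisibility can be pulled back through it. -/
lemma isCylinder [DecidableEq κ] (h : F.Induces G s o) {w p : ℝ} (hw : 0 ≤ w) {c : List κ}
    (hc : G.IsCylinder w p c) : F.IsCylinder w (p + o) (c.flatMap s) where
  fits := h.fits_flatMap hw hc.fits
  disp_eq := by rw [h.disp_flatMap, hc.disp_eq]
  primitive k hk := by
    refine hc.primitive k (h.primitive k (fun j => c.count j) fun i => ?_)
    rw [← count_flatMap_eq_sum]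
    exact hk i

lemma meets (h : F.Induces G s o) {w p z : ℝ} {c : List κ} {i : ι} {j : κ} {u v : List ι}
    (hs : s j = u ++ i :: v) (hz : G.Meets w p c j (z - o - F.disp u)) :
    F.Meets w (p + o) (c.flatMap s) i z := by
  obtain ⟨u', v', rfl, h1, h2⟩ := hz
  refine ⟨u'.flatMap s ++ u, v ++ v'.flatMap s, by simp [hs], ?_, ?_⟩ <;>
    rw [disp_append, h.disp_flatMap] <;> linarith

/-- Substituting the return words into both cyclic words leaves the widths unchanged, so only the
counts grow. -/
lemma isDecomposition [DecidableEq κ] (h : F.Induces G s o) {w₁ w₂ p₁ p₂ : ℝ} (hw₁ : 0 ≤ w₁)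
    (hw₂ : 0 ≤ w₂) {c₁ c₂ : List κ} (hG : G.IsDecomposition w₁ w₂ p₁ c₁ p₂ c₂) :
    F.IsDecomposition w₁ w₂ (p₁ + o) (c₁.flatMap s) (p₂ + o) (c₂.flatMap s) where
  cyl₁ := h.isCylinder hw₁ hG.cyl₁
  cyl₂ := h.isCylinder hw₂ hG.cyl₂
  length_eq i := by
    rw [h.length_eq, count_flatMap_eq_sum, count_flatMap_eq_sum]
    push_cast
    rw [Finset.mul_sum, Finset.mul_sum, ← Finset.sum_add_distrib]
    refine Finset.sum_congr rfl fun j _ => ?_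
    rw [hG.length_eq]
    ring
  cover i z hi h1 h2 := by
    obtain ⟨j, u, v, hs, hj, h3, h4⟩ := h.cover i z hi h1 h2
    exact (hG.cover j _ hj h3 h4).imp (h.meets hs) (h.meets hs)

end Induces

/-! ### The exchange of four intervals on the diagonal -/

/-- The exchange of four consecutive intervals of lengths `a, b, c, d` which puts them into the
order second, fourth, first, third. -/
def exchange (a b c d : ℝ) : IntervalExchange (Fin 4) where
  lo := ![0, a, a + b, a + b + c]
  hi := ![a, a + b, a + b + c, a + b + c + d]
  t := ![b + d, -a, d, -a - c]

/-- In this and the next three lemmas `a` and `b` stand for φx and φy. Only linear inequalities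
between the lengths matter, so φ is kept out and everything reduces to linear arithmetic. -/
lemma induces_zero {x a y b : ℝ} (hx : 0 < x) (hy : 0 ≤ y) (ha : x ≤ a)
    (hb : y ≤ b) (hb' : b ≤ 2 * y) :
    (exchange b (x + b) y (a + b + y)).Induces (exchange b x y a)
      ![[1, 0, 3], [1], [2, 3], [3]] b where
  fits j p w hw h1 h2 := by
    fin_cases j <;> simp [exchange, Fits] at h1 h2 ⊢ <;>
      (repeat' apply And.intro) <;> linarith
  disp_eq j := by
    fin_cases j <;> simp [exchange] <;> ring
  length_eq i := by
    fin_cases i <;> simp [exchange, Fin.sum_univ_succ] <;> ring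
  primitive k m hk := by
    obtain ⟨c0, h0⟩ := hk 0
    obtain ⟨c1, h1⟩ := hk 1
    obtain ⟨c2, h2⟩ := hk 2
    obtain ⟨c3, h3⟩ := hk 3
    simp [Fin.sum_univ_succ] at h0 h1 h2 h3
    zify at h0 h1 h2 h3 ⊢
    -- The coefficients below are the entries of the inverse of the count matrix, which is integral.
    intro j
    fin_cases j
    · exact ⟨c0, by dsimp; linarith⟩
    · exact ⟨-c0 + c1, by dsimp; linarith⟩
    · exact ⟨c2, by dsimp; linarith⟩
    · exact ⟨-c0 - c2 + c3, by dsimp; linarith⟩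
  cover i z hi h1 h2 := by
    -- Intervals of length zero may not serve as witnesses, and `y` and `b` vanish only together.
    -- The cut points below separate the occurrences of a letter in the return words.
    have hyb : (y = 0 ∧ b = 0) ∨ (0 < y ∧ 0 < b) := by
      rcases hy.eq_or_lt with h | h
      · exact Or.inl ⟨h.symm, by linarith⟩
      · exact Or.inr ⟨h, by linarith⟩
    fin_cases i <;> simp [exchange] at hi h1 h2
    · exact ⟨0, [1], [3], rfl, by simp [exchange]; linarith, by simp [exchange]; linarith,
        by simp [exchange]; linarith⟩
    · have h3 := le_total z (b + b)
      rcases hyb with ⟨rfl, rfl⟩ | ⟨hy, hb⟩ <;> rcases h3 with h3 | h3 <;>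
      first
      | exact ⟨0, [], [0, 3], rfl, by simp [exchange]; linarith, by simp [exchange]; linarith,
          by simp [exchange]; linarith⟩
      | exact ⟨1, [], [], rfl, by simp [exchange]; linarith, by simp [exchange]; linarith,
          by simp [exchange]; linarith⟩
    · exact ⟨2, [], [3], rfl, by simp [exchange]; linarith, by simp [exchange]; linarith,
        by simp [exchange]; linarith⟩
    · have h3 := le_total z (b + x + b + y + a)
      have h4 := le_total z (b + x + b + y + a + b)
      rcases hyb with ⟨rfl, rfl⟩ | ⟨hy, hb⟩ <;> rcases h3 with h3 | h3 <;>
        rcases h4 with h4 | h4 <;>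
      first
      | exact ⟨3, [], [], rfl, by simp [exchange]; linarith, by simp [exchange]; linarith,
          by simp [exchange]; linarith⟩
      | exact ⟨0, [1, 0], [], rfl, by simp [exchange]; linarith, by simp [exchange]; linarith,
          by simp [exchange]; linarith⟩
      | exact ⟨2, [2], [], rfl, by simp [exchange]; linarith, by simp [exchange]; linarith,
          by simp [exchange]; linarith⟩

lemma induces_one {x a y b : ℝ} (hx : 0 < x) (hy : 0 ≤ y) (ha : x ≤ a)
    (hb : y ≤ b) (hb' : b ≤ 2 * y) :
    (exchange (a + b + y) (a + b) (x + b) (a + x + b + y)).Induces (exchange b x y a)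
      ![[2, 3, 1, 0], [2, 3], [3, 0], [3, 1, 0]] (2 * a + y + 2 * b) where
  fits j p w hw h1 h2 := by
    fin_cases j <;> simp [exchange, Fits] at h1 h2 ⊢ <;>
      (repeat' apply And.intro) <;> linarith
  disp_eq j := by
    fin_cases j <;> simp [exchange] <;> ring
  length_eq i := by
    fin_cases i <;> simp [exchange, Fin.sum_univ_succ] <;> ring
  primitive k m hk := by
    obtain ⟨c0, h0⟩ := hk 0
    obtain ⟨c1, h1⟩ := hk 1
    obtain ⟨c2, h2⟩ := hk 2
    obtain ⟨c3, h3⟩ := hk 3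
    simp [Fin.sum_univ_succ] at h0 h1 h2 h3
    zify at h0 h1 h2 h3 ⊢
    intro j
    fin_cases j
    · exact ⟨c0 + c2 - c3, by dsimp; linarith⟩
    · exact ⟨-c0 + c3, by dsimp; linarith⟩
    · exact ⟨c0 - c1, by dsimp; linarith⟩
    · exact ⟨-c0 + c1 - c2 + c3, by dsimp; linarith⟩
  cover i z hi h1 h2 := by
    have hyb : (y = 0 ∧ b = 0) ∨ (0 < y ∧ 0 < b) := by
      rcases hy.eq_or_lt with h | h
      · exact Or.inl ⟨h.symm, by linarith⟩
      · exact Or.inr ⟨h, by linarith⟩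
    fin_cases i <;> simp [exchange] at hi h1 h2
    · have h3 := le_total z (a)
      have h4 := le_total z (a + b)
      rcases hyb with ⟨rfl, rfl⟩ | ⟨hy, hb⟩ <;> rcases h3 with h3 | h3 <;>
        rcases h4 with h4 | h4 <;>
      first
      | exact ⟨3, [3, 1], [], rfl, by simp [exchange]; linarith, by simp [exchange]; linarith,
          by simp [exchange]; linarith⟩
      | exact ⟨0, [2, 3, 1], [], rfl, by simp [exchange]; linarith, by simp [exchange]; linarith,
          by simp [exchange]; linarith⟩
      | exact ⟨2, [3], [], rfl, by simp [exchange]; linarith, by simp [exchange]; linarith,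
          by simp [exchange]; linarith⟩
    · have h3 := le_total z (a + b + y + a)
      rcases hyb with ⟨rfl, rfl⟩ | ⟨hy, hb⟩ <;> rcases h3 with h3 | h3 <;>
      first
      | exact ⟨3, [3], [0], rfl, by simp [exchange]; linarith, by simp [exchange]; linarith,
          by simp [exchange]; linarith⟩
      | exact ⟨0, [2, 3], [0], rfl, by simp [exchange]; linarith, by simp [exchange]; linarith,
          by simp [exchange]; linarith⟩
    · have h3 := le_total z (a + b + y + a + b + b)
      rcases hyb with ⟨rfl, rfl⟩ | ⟨hy, hb⟩ <;> rcases h3 with h3 | h3 <;>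
      first
      | exact ⟨0, [], [3, 1, 0], rfl, by simp [exchange]; linarith, by simp [exchange]; linarith,
          by simp [exchange]; linarith⟩
      | exact ⟨1, [], [3], rfl, by simp [exchange]; linarith, by simp [exchange]; linarith,
          by simp [exchange]; linarith⟩
    · have h3 := le_total z (a + b + y + a + b + x + b + y)
      have h4 := le_total z (a + b + y + a + b + x + b + y + a)
      have h5 := le_total z (a + b + y + a + b + x + b + y + a + b)
      rcases hyb with ⟨rfl, rfl⟩ | ⟨hy, hb⟩ <;> rcases h3 with h3 | h3 <;>
        rcases h4 with h4 | h4 <;>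
        rcases h5 with h5 | h5 <;>
      first
      | exact ⟨2, [], [0], rfl, by simp [exchange]; linarith, by simp [exchange]; linarith,
          by simp [exchange]; linarith⟩
      | exact ⟨3, [], [1, 0], rfl, by simp [exchange]; linarith, by simp [exchange]; linarith,
          by simp [exchange]; linarith⟩
      | exact ⟨0, [2], [1, 0], rfl, by simp [exchange]; linarith, by simp [exchange]; linarith,
          by simp [exchange]; linarith⟩
      | exact ⟨1, [2], [], rfl, by simp [exchange]; linarith, by simp [exchange]; linarith,
          by simp [exchange]; linarith⟩

lemma induces_two {x a y b : ℝ} (hx : 0 < x) (hy : 0 ≤ y) (ha : x ≤ a)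
    (hb : y ≤ b) (hb' : b ≤ 2 * y) :
    (exchange (a + x + b + y) (a + y) (a + b) (a + x + b)).Induces (exchange b x y a)
      ![[0, 2, 3], [0, 3], [1, 0], [1, 0, 2, 3]] (a + y) where
  fits j p w hw h1 h2 := by
    fin_cases j <;> simp [exchange, Fits] at h1 h2 ⊢ <;>
      (repeat' apply And.intro) <;> linarith
  disp_eq j := by
    fin_cases j <;> simp [exchange] <;> ring
  length_eq i := by
    fin_cases i <;> simp [exchange, Fin.sum_univ_succ] <;> ring
  primitive k m hk := by
    obtain ⟨c0, h0⟩ := hk 0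
    obtain ⟨c1, h1⟩ := hk 1
    obtain ⟨c2, h2⟩ := hk 2
    obtain ⟨c3, h3⟩ := hk 3
    simp [Fin.sum_univ_succ] at h0 h1 h2 h3
    zify at h0 h1 h2 h3 ⊢
    intro j
    fin_cases j
    · exact ⟨c0 - c1 + c2 - c3, by dsimp; linarith⟩
    · exact ⟨-c2 + c3, by dsimp; linarith⟩
    · exact ⟨c0 - c3, by dsimp; linarith⟩
    · exact ⟨-c0 + c1 + c3, by dsimp; linarith⟩
  cover i z hi h1 h2 := by
    have hyb : (y = 0 ∧ b = 0) ∨ (0 < y ∧ 0 < b) := by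
      rcases hy.eq_or_lt with h | h
      · exact Or.inl ⟨h.symm, by linarith⟩
      · exact Or.inr ⟨h, by linarith⟩
    fin_cases i <;> simp [exchange] at hi h1 h2
    · have h3 := le_total z (y)
      have h4 := le_total z (y + a)
      have h5 := le_total z (y + a + b)
      rcases hyb with ⟨rfl, rfl⟩ | ⟨hy, hb⟩ <;> rcases h3 with h3 | h3 <;>
        rcases h4 with h4 | h4 <;>
        rcases h5 with h5 | h5 <;>
      first
      | exact ⟨2, [1], [], rfl, by simp [exchange]; linarith, by simp [exchange]; linarith,
          by simp [exchange]; linarith⟩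
      | exact ⟨3, [1], [2, 3], rfl, by simp [exchange]; linarith, by simp [exchange]; linarith,
          by simp [exchange]; linarith⟩
      | exact ⟨0, [], [2, 3], rfl, by simp [exchange]; linarith, by simp [exchange]; linarith,
          by simp [exchange]; linarith⟩
      | exact ⟨1, [], [3], rfl, by simp [exchange]; linarith, by simp [exchange]; linarith,
          by simp [exchange]; linarith⟩
    · have h3 := le_total z (a + x + b + y + y)
      rcases hyb with ⟨rfl, rfl⟩ | ⟨hy, hb⟩ <;> rcases h3 with h3 | h3 <;>
      first
      | exact ⟨2, [], [0], rfl, by simp [exchange]; linarith, by simp [exchange]; linarith,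
          by simp [exchange]; linarith⟩
      | exact ⟨3, [], [0, 2, 3], rfl, by simp [exchange]; linarith, by simp [exchange]; linarith,
          by simp [exchange]; linarith⟩
    · have h3 := le_total z (a + x + b + y + a + y + a)
      rcases hyb with ⟨rfl, rfl⟩ | ⟨hy, hb⟩ <;> rcases h3 with h3 | h3 <;>
      first
      | exact ⟨3, [1, 0], [3], rfl, by simp [exchange]; linarith, by simp [exchange]; linarith,
          by simp [exchange]; linarith⟩
      | exact ⟨0, [0], [3], rfl, by simp [exchange]; linarith, by simp [exchange]; linarith,
          by simp [exchange]; linarith⟩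
    · have h3 := le_total z (a + x + b + y + a + y + a + b + x)
      have h4 := le_total z (a + x + b + y + a + y + a + b + x + a)
      rcases hyb with ⟨rfl, rfl⟩ | ⟨hy, hb⟩ <;> rcases h3 with h3 | h3 <;>
        rcases h4 with h4 | h4 <;>
      first
      | exact ⟨1, [0], [], rfl, by simp [exchange]; linarith, by simp [exchange]; linarith,
          by simp [exchange]; linarith⟩
      | exact ⟨3, [1, 0, 2], [], rfl, by simp [exchange]; linarith, by simp [exchange]; linarith,
          by simp [exchange]; linarith⟩
      | exact ⟨0, [0, 2], [], rfl, by simp [exchange]; linarith, by simp [exchange]; linarith,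
          by simp [exchange]; linarith⟩

lemma induces_three {x a y b : ℝ} (hx : 0 < x) (hy : 0 ≤ y) (ha : x ≤ a)
    (hb : y ≤ b) (hb' : b ≤ 2 * y) :
    (exchange (a + x + b) x (a + y) a).Induces (exchange b x y a)
      ![[0], [1, 0], [2], [2, 3, 0]] (x + a) where
  fits j p w hw h1 h2 := by
    fin_cases j <;> simp [exchange, Fits] at h1 h2 ⊢ <;>
      (repeat' apply And.intro) <;> linarith
  disp_eq j := by
    fin_cases j <;> simp [exchange] <;> ring
  length_eq i := by
    fin_cases i <;> simp [exchange, Fin.sum_univ_succ] <;> ring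
  primitive k m hk := by
    obtain ⟨c0, h0⟩ := hk 0
    obtain ⟨c1, h1⟩ := hk 1
    obtain ⟨c2, h2⟩ := hk 2
    obtain ⟨c3, h3⟩ := hk 3
    simp [Fin.sum_univ_succ] at h0 h1 h2 h3
    zify at h0 h1 h2 h3 ⊢
    intro j
    fin_cases j
    · exact ⟨c0 - c1 - c3, by dsimp; linarith⟩
    · exact ⟨c1, by dsimp; linarith⟩
    · exact ⟨c2 - c3, by dsimp; linarith⟩
    · exact ⟨c3, by dsimp; linarith⟩
  cover i z hi h1 h2 := by
    have hyb : (y = 0 ∧ b = 0) ∨ (0 < y ∧ 0 < b) := by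
      rcases hy.eq_or_lt with h | h
      · exact Or.inl ⟨h.symm, by linarith⟩
      · exact Or.inr ⟨h, by linarith⟩
    fin_cases i <;> simp [exchange] at hi h1 h2
    · have h3 := le_total z (x)
      have h4 := le_total z (x + a)
      rcases hyb with ⟨rfl, rfl⟩ | ⟨hy, hb⟩ <;> rcases h3 with h3 | h3 <;>
        rcases h4 with h4 | h4 <;>
      first
      | exact ⟨1, [1], [], rfl, by simp [exchange]; linarith, by simp [exchange]; linarith,
          by simp [exchange]; linarith⟩
      | exact ⟨3, [2, 3], [], rfl, by simp [exchange]; linarith, by simp [exchange]; linarith,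
          by simp [exchange]; linarith⟩
      | exact ⟨0, [], [], rfl, by simp [exchange]; linarith, by simp [exchange]; linarith,
          by simp [exchange]; linarith⟩
    · exact ⟨1, [], [0], rfl, by simp [exchange]; linarith, by simp [exchange]; linarith,
        by simp [exchange]; linarith⟩
    · have h3 := le_total z (a + x + b + x + y)
      rcases hyb with ⟨rfl, rfl⟩ | ⟨hy, hb⟩ <;> rcases h3 with h3 | h3 <;>
      first
      | exact ⟨2, [], [], rfl, by simp [exchange]; linarith, by simp [exchange]; linarith,
          by simp [exchange]; linarith⟩
      | exact ⟨3, [], [3, 0], rfl, by simp [exchange]; linarith, by simp [exchange]; linarith,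
          by simp [exchange]; linarith⟩
    · exact ⟨3, [2], [0], rfl, by simp [exchange]; linarith, by simp [exchange]; linarith,
        by simp [exchange]; linarith⟩

end IntervalExchange

/-! ### Orbits of an interval exchange and periodic strips -/

namespace IntervalExchange

variable {ι : Type*}

/-- A bi-infinite orbit, with its itinerary `v`, that avoids the end points of the intervals. -/
structure IsOrbit (F : IntervalExchange ι) (v : ℤ → ι) (x : ℤ → ℝ) : Prop where
  lo_lt : ∀ m, F.lo (v m) < x m
  lt_hi : ∀ m, x m < F.hi (v m)
  step : ∀ m, x (m + 1) = x m + F.t (v m)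

/-- A closed chain of `N` intervals `[q m, q m + w]` with the itinerary `g`. -/
structure IsStrip (F : IntervalExchange ι) (w : ℝ) (N : ℕ) (g : ℤ → ι) (q : ℤ → ℝ) : Prop where
  pos : 0 < N
  periodic_letter : Function.Periodic g N
  periodic_pos : Function.Periodic q N
  lo_le : ∀ m, F.lo (g m) ≤ q m
  le_hi : ∀ m, q m + w ≤ F.hi (g m)
  step : ∀ m, q (m + 1) = q m + F.t (g m)

lemma fits_iff_getElem {F : IntervalExchange ι} {w : ℝ} {l : List ι} : ∀ {p : ℝ},
    F.Fits w p l ↔ ∀ (k : ℕ) (hk : k < l.length),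
      F.lo l[k] ≤ p + F.disp (l.take k) ∧ p + F.disp (l.take k) + w ≤ F.hi l[k] := by
  induction l with
  | nil => intro p; simp [Fits]
  | cons i l ih =>
    intro p
    rw [Fits, ih]
    constructor
    · rintro ⟨h1, h2, h3⟩ (_ | k) hk
      · simpa using ⟨h1, h2⟩
      · simpa [add_assoc] using h3 k (by simpa using hk)
    · intro h
      have h0 := h 0 (by simp)
      simp at h0
      refine ⟨h0.1, h0.2, fun k hk => ?_⟩
      have h1 := h (k + 1) (by simpa using hk)
      rw [List.getElem_cons_succ] at h1
      simpa [add_assoc] using h1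

lemma IsCylinder.ne_nil [DecidableEq ι] {F : IntervalExchange ι} {w p : ℝ} {l : List ι}
    (hc : F.IsCylinder w p l) : l ≠ [] := by
  rintro rfl
  -- All counts of the empty word are 0, hence divisible by 2.
  have := hc.primitive 2 (by simp)
  omega

/-- A cylinder, as a bi-infinite periodic chain of intervals. -/
lemma IsCylinder.exists_isStrip [DecidableEq ι] {F : IntervalExchange ι} {w p : ℝ} {l : List ι}
    (hc : F.IsCylinder w p l) : ∃ g q, F.IsStrip w l.length g q ∧
      (∀ i, Nat.count (fun k : ℕ => g k = i) l.length = l.count i) ∧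
      ∀ i z, F.Meets w p l i z → ∃ m, q m ≤ z ∧ z ≤ q m + w := by
  have hN : 0 < l.length := List.length_pos_of_ne_nil hc.ne_nil
  have hN' : (l.length : ℤ) ≠ 0 := by positivity
  have hlt : ∀ m : ℤ, (m % l.length).toNat < l.length := fun m => by
    have := Int.emod_lt_of_pos m (show (0 : ℤ) < l.length by exact_mod_cast hN)
    have := Int.emod_nonneg m hN'
    omega
  have hmod : ∀ k : ℕ, k < l.length → ((k : ℤ) % l.length).toNat = k := fun k hk => by
    rw [Int.emod_eq_of_lt (by positivity) (by exact_mod_cast hk)]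
    simp
  have hfit := fits_iff_getElem.1 hc.fits
  refine ⟨fun m => l[(m % l.length).toNat]'(hlt m),
    fun m => p + F.disp (l.take (m % l.length).toNat), ⟨hN, ?_, ?_, ?_, ?_, ?_⟩, ?_, ?_⟩
  · intro m; simp
  · intro m; simp
  · intro m; exact (hfit _ (hlt m)).1
  · intro m; exact (hfit _ (hlt m)).2
  · intro m
    have hsucc : F.disp (l.take ((m % l.length).toNat + 1)) =
        F.disp (l.take (m % l.length).toNat) + F.t (l[(m % l.length).toNat]'(hlt m)) := by
      rw [List.take_succ_eq_append_getElem (hlt m), disp_append, disp_cons, disp_nil, add_zero]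
    rw [add_assoc, ← hsucc]
    congr 1
    have h0 := Int.emod_nonneg m hN'
    have h1 := hlt m
    by_cases h : (m % l.length).toNat + 1 = l.length
    · have h2 : (m + 1) % l.length = 0 := by
        rw [← Int.emod_add_emod, show m % l.length = l.length - 1 by omega, sub_add_cancel,
          Int.emod_self]
      rw [h2, h]
      simp [hc.disp_eq]
    · have h2 : ((m + 1) % l.length).toNat = (m % l.length).toNat + 1 := by
        have : (m + 1) % l.length = m % l.length + 1 := by
          rw [← Int.emod_add_emod]
          exact Int.emod_eq_of_lt (by omega) (by omega)
        omega
      rw [h2]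
  · intro i
    have : ∀ k ≤ l.length, Nat.count (fun k : ℕ => l[((k : ℤ) % l.length).toNat]'(hlt k) = i) k =
        (l.take k).count i := by
      intro k
      induction k with
      | zero => simp
      | succ k ih =>
        intro hk
        rw [Nat.count_succ, ih (by omega), List.take_succ_eq_append_getElem (by omega),
          List.count_append]
        simp only [hmod k (by omega), List.count_singleton, beq_iff_eq]
    simpa using this _ le_rfl
  · rintro i z ⟨u, v, rfl, h1, h2⟩
    refine ⟨u.length, ?_⟩
    dsimp only
    rw [hmod _ (by simp)]
    simpa using ⟨h1, h2⟩

lemma count_mul_of_periodic {P : ℕ → Prop} [DecidablePred P] {d : ℕ}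
    (h : ∀ k, P (d + k) ↔ P k) (j : ℕ) : Nat.count P (d * j) = j * Nat.count P d := by
  induction j with
  | zero => simp
  | succ j ih =>
    rw [Nat.mul_succ, add_comm (d * j), Nat.count_add]
    simp only [h, ih]
    ring

/-- If `r` is a period, so is d = gcd(N, r). A block of length N then consists of N / d equal
blocks, so N / d divides every letter count and equals 1. -/
lemma isLeast_period {g : ℤ → ι} [DecidableEq ι] {N : ℕ} (hN : 0 < N) (hg : Function.Periodic g N)
    (h : ∀ k : ℕ, (∀ i, k ∣ Nat.count (fun j : ℕ => g j = i) N) → k = 1) :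
    IsLeast {r : ℕ | 0 < r ∧ ∀ m : ℤ, g (m + r) = g m} N := by
  refine ⟨⟨hN, hg⟩, ?_⟩
  rintro r ⟨hr, hg'⟩
  have hd : Function.Periodic g (Nat.gcd N r : ℕ) := by
    rw [Nat.gcd_eq_gcd_ab, mul_comm (N : ℤ), mul_comm (r : ℤ)]
    exact Function.Periodic.add_period (hg.int_mul _) (Function.Periodic.int_mul hg' _)
  obtain ⟨e, he⟩ := Nat.gcd_dvd_left N r
  have := h e fun i => by
    rw [he, count_mul_of_periodic]
    · exact dvd_mul_right _ _
    · intro k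
      rw [show (((Nat.gcd N r + k : ℕ)) : ℤ) = k + (Nat.gcd N r : ℕ) by push_cast; ring, hd k]
  rw [this, mul_one] at he
  rw [he]
  exact Nat.gcd_le_right _ hr

/-- The number of occurrences of a letter in a period does not depend on the starting point. -/
lemma count_shift {g : ℤ → ι} [DecidableEq ι] {N : ℕ} (hg : Function.Periodic g N) (i : ι) (k : ℤ) :
    Nat.count (fun j : ℕ => g (j + k) = i) N = Nat.count (fun j : ℕ => g j = i) N := by
  have hstep : ∀ k : ℤ, Nat.count (fun j : ℕ => g (j + (k + 1)) = i) N =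
      Nat.count (fun j : ℕ => g (j + k) = i) N := by
    intro k
    have h1 := Nat.count_succ (fun j : ℕ => g (j + k) = i) N
    have h2 := Nat.count_succ' (fun j : ℕ => g (j + k) = i) N
    have h3 : g ((N : ℤ) + k) = g ((0 : ℕ) + k) := by rw [add_comm, hg]; simp
    simp only [h3] at h1
    rw [h1] at h2
    have h4 := Nat.add_right_cancel h2
    rw [h4]
    congr! 3
    push_cast
    ring_nf
  induction k using Int.induction_on with
  | zero => simp
  | succ k ih => rw [hstep, ih]
  | pred k ih => rw [← hstep, sub_add_cancel, ih]

lemma eq_of_periodic {β : Type*} {f h : ℤ → β} {N : ℕ} (hN : 0 < N) (hf : Function.Periodic f N)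
    (hh : Function.Periodic h N) (heq : ∀ j : ℕ, f j = h j) (m : ℤ) : f m = h m := by
  have h1 : f (m + m.natAbs * N) = f m := (hf.int_mul m.natAbs) m
  have h2 : h (m + m.natAbs * N) = h m := (hh.int_mul m.natAbs) m
  have h3 : 0 ≤ m + m.natAbs * (N : ℤ) := by
    have : (m.natAbs : ℤ) ≤ m.natAbs * (N : ℤ) :=
      le_mul_of_one_le_right (by positivity) (by exact_mod_cast hN)
    omega
  obtain ⟨j, hj⟩ := Int.eq_ofNat_of_zero_le h3
  rw [← h1, ← h2, hj]
  exact heq j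

namespace IsStrip

variable {F : IntervalExchange ι} {w : ℝ} {N : ℕ} {g : ℤ → ι} {q : ℤ → ℝ}

lemma isOrbit (h : F.IsStrip w N g q) (hw : 0 < w) : F.IsOrbit g (fun m => q m + w / 2) where
  lo_lt m := by have := h.lo_le m; linarith
  lt_hi m := by have := h.le_hi m; linarith
  step m := by rw [h.step]; ring

/-- An orbit point lies strictly inside its interval, and the intervals have disjoint interiors, so
the strip containing the point must carry the same letter, even when the point is on the edge of the
strip. -/
lemma follow (h : F.IsStrip w N g q) (hF : ∀ i j, i ≠ j → F.hi i ≤ F.lo j ∨ F.hi j ≤ F.lo i)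
    {v : ℤ → ι} {x : ℤ → ℝ} (ho : F.IsOrbit v x) {m k : ℤ} (h1 : q k ≤ x m) (h2 : x m ≤ q k + w) :
    ∀ j : ℕ, x (m + j) = x m + (q (k + j) - q k) ∧ v (m + j) = g (k + j) := by
  have key : ∀ j : ℕ, x (m + j) = x m + (q (k + j) - q k) → v (m + j) = g (k + j) := by
    intro j hj
    by_contra hne
    have := h.lo_le (k + j)
    have := h.le_hi (k + j)
    have := ho.lo_lt (m + j)
    have := ho.lt_hi (m + j)
    rcases hF _ _ hne with h' | h' <;> linarith
  have hx : ∀ j : ℕ, x (m + j) = x m + (q (k + j) - q k) := by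
    intro j
    induction j with
    | zero => simp
    | succ j ih =>
      push_cast
      rw [← add_assoc, ← add_assoc, ho.step, h.step, key j ih, ih]
      ring
  exact fun j => ⟨hx j, key j (hx j)⟩

lemma orbit_eq_of_forall (h : F.IsStrip w N g q)
    (hF : ∀ i j, i ≠ j → F.hi i ≤ F.lo j ∨ F.hi j ≤ F.lo i)
    {v : ℤ → ι} {x : ℤ → ℝ} (ho : F.IsOrbit v x) (hx : ∀ m, ∃ k, q k ≤ x m ∧ x m ≤ q k + w) :
    Function.Periodic v N ∧ Function.Periodic x N ∧ ∃ k, ∀ m, v (m + k) = g m := by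
  have hv : Function.Periodic v N := fun m => by
    obtain ⟨k, h1, h2⟩ := hx m
    have e1 := (h.follow hF ho h1 h2 N).2
    have e2 := (h.follow hF ho h1 h2 0).2
    rw [h.periodic_letter] at e1
    simp at e2
    rw [e1, e2]
  refine ⟨hv, fun m => ?_, ?_⟩
  · obtain ⟨k, h1, h2⟩ := hx m
    rw [(h.follow hF ho h1 h2 N).1, h.periodic_pos]
    ring
  · obtain ⟨k, h1, h2⟩ := hx 0
    refine ⟨-k, fun m => ?_⟩
    have := eq_of_periodic (h := fun j => g (k + j)) h.pos hv
      (fun j => by simpa [add_assoc] using h.periodic_letter (k + j))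
      (fun j => by simpa using (h.follow hF ho h1 h2 j).2) (m + -k)
    rw [this]
    simp

end IsStrip

/-- An orbit stays in one of the strips that cover the intervals. -/
lemma IsOrbit.eq_or_eq {F : IntervalExchange ι}
    (hF : ∀ i j, i ≠ j → F.hi i ≤ F.lo j ∨ F.hi j ≤ F.lo i)
    {w₁ w₂ : ℝ} {N₁ N₂ : ℕ} {g₁ g₂ : ℤ → ι} {q₁ q₂ : ℤ → ℝ} (h₁ : F.IsStrip w₁ N₁ g₁ q₁)
    (h₂ : F.IsStrip w₂ N₂ g₂ q₂)
    (hcover : ∀ i z, F.lo i < z → z < F.hi i →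
      (∃ m, q₁ m ≤ z ∧ z ≤ q₁ m + w₁) ∨ (∃ m, q₂ m ≤ z ∧ z ≤ q₂ m + w₂))
    {v : ℤ → ι} {x : ℤ → ℝ} (ho : F.IsOrbit v x) :
    (Function.Periodic v N₁ ∧ Function.Periodic x N₁ ∧ ∃ k, ∀ m, v (m + k) = g₁ m) ∨
    (Function.Periodic v N₂ ∧ Function.Periodic x N₂ ∧ ∃ k, ∀ m, v (m + k) = g₂ m) := by
  have hc := fun m => hcover (v m) (x m) (ho.lo_lt m) (ho.lt_hi m)
  by_cases h : ∀ m, ∃ k, q₁ k ≤ x m ∧ x m ≤ q₁ k + w₁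
  · exact Or.inl (h₁.orbit_eq_of_forall hF ho h)
  · push Not at h
    obtain ⟨m₀, hm₀⟩ := h
    refine Or.inr (h₂.orbit_eq_of_forall hF ho fun m => ?_)
    -- Strips are followed forwards only: an earlier visit to the first strip would force `x m₀`
    -- into it. Hence the past of `m₀` lies in the second strip, which then carries the future
    -- along.
    have hlt : ∀ m ≤ m₀, ∃ k, q₂ k ≤ x m ∧ x m ≤ q₂ k + w₂ := by
      intro m hm
      refine (hc m).resolve_left ?_
      rintro ⟨k, h1, h2⟩
      obtain ⟨j, rfl⟩ := Int.le.dest hm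
      have := (h₁.follow hF ho h1 h2 j).1
      have := hm₀ (k + j) (by linarith)
      linarith
    obtain ⟨k, h1, h2⟩ := hlt (min m m₀) (min_le_right _ _)
    obtain ⟨j, hj⟩ := Int.le.dest (min_le_left m m₀)
    have := (h₂.follow hF ho h1 h2 j).1
    rw [hj] at this
    exact ⟨k + j, by linarith, by linarith⟩

end IntervalExchange

/-! ### Renormalization of the golden exchange and the count of periods -/

lemma goldenRatio_mul_self : φ * φ = φ + 1 := by rw [← sq, Real.goldenRatio_sq]

lemma eq_and_eq_of_add_goldenRatio_mul_eq {a b c d : ℤ}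
    (h : (a : ℝ) + φ * b = c + φ * d) : a = c ∧ b = d := by
  have hbd : b = d := by
    by_contra hne
    have hsub : ((b - d : ℤ) : ℝ) ≠ 0 := by exact_mod_cast sub_ne_zero.2 hne
    refine Real.goldenRatio_irrational ⟨((c - a : ℤ) : ℚ) / ((b - d : ℤ) : ℚ), ?_⟩
    push_cast at hsub ⊢
    rw [div_eq_iff hsub]
    linarith
  subst hbd
  exact ⟨by exact_mod_cast add_right_cancel h, rfl⟩

open IntervalExchange

/-- The interval exchange on the diagonal, for the direction with the homogeneous coordinates
`x : y` in the sector. -/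
def goldenExchange (x y : ℝ) : IntervalExchange (Fin 4) := exchange (φ * y) x y (φ * x)

lemma goldenExchange_separated {x y : ℝ} (hx : 0 ≤ x) (hy : 0 ≤ y) (i j : Fin 4) (hij : i ≠ j) :
    (goldenExchange x y).hi i ≤ (goldenExchange x y).lo j ∨
      (goldenExchange x y).hi j ≤ (goldenExchange x y).lo i := by
  have h1 : 0 ≤ φ * x := mul_nonneg Real.goldenRatio_pos.le hx
  have h2 : 0 ≤ φ * y := mul_nonneg Real.goldenRatio_pos.le hy
  fin_cases i <;> fin_cases j <;> try exact absurd rfl hij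
  all_goals
    simp [goldenExchange, exchange] <;>
    first | (left; linarith) | (right; linarith)

/-- The point `x : y` of the sector with the given itinerary, in homogeneous coordinates. -/
def ray {k : ℕ} (n : Fin k → Fin 4) : Fin 2 → ℝ :=
  ![1, 0] ᵥ* (List.ofFn fun i => X (n i)).reverse.prod

lemma ray_zero (n : Fin 0 → Fin 4) : ray n = ![1, 0] := by simp [ray]

/-- The first index is the rightmost factor, so dropping it is one step of renormalization. -/
lemma ray_succ {k : ℕ} (n : Fin (k + 1) → Fin 4) :
    ray n = ray (fun i => n i.succ) ᵥ* X (n 0) := by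
  simp [ray, List.ofFn_succ, Matrix.vecMul_vecMul]

lemma vecMul_X_zero (r : Fin 2 → ℝ) : r ᵥ* X 0 = ![r 0 + φ * r 1, r 1] := by
  ext i; fin_cases i <;> simp [X, Matrix.vecMul, dotProduct, Fin.sum_univ_two] <;> ring

lemma vecMul_X_one (r : Fin 2 → ℝ) : r ᵥ* X 1 = ![φ * r 0 + φ * r 1, r 0 + φ * r 1] := by
  ext i; fin_cases i <;> simp [X, Matrix.vecMul, dotProduct, Fin.sum_univ_two] <;> ring

lemma vecMul_X_two (r : Fin 2 → ℝ) : r ᵥ* X 2 = ![φ * r 0 + r 1, φ * r 0 + φ * r 1] := by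
  ext i; fin_cases i <;> simp [X, Matrix.vecMul, dotProduct, Fin.sum_univ_two] <;> ring

lemma vecMul_X_three (r : Fin 2 → ℝ) : r ᵥ* X 3 = ![r 0, φ * r 0 + r 1] := by
  ext i; fin_cases i <;> simp [X, Matrix.vecMul, dotProduct, Fin.sum_univ_two] <;> ring

lemma ray_nonneg {k : ℕ} (n : Fin k → Fin 4) : 0 < ray n 0 ∧ 0 ≤ ray n 1 := by
  induction k with
  | zero => simp [ray_zero]
  | succ k ih =>
    obtain ⟨h0, h1⟩ := ih fun i => n i.succ
    have hφ := Real.goldenRatio_pos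
    rw [ray_succ]
    generalize n 0 = m
    fin_cases m
    · simp only [Fin.zero_eta, vecMul_X_zero]
      exact ⟨by dsimp; positivity, by dsimp; positivity⟩
    · simp only [Fin.mk_one, vecMul_X_one]
      exact ⟨by dsimp; positivity, by dsimp; positivity⟩
    · simp only [Fin.reduceFinMk, vecMul_X_two]
      exact ⟨by dsimp; positivity, by dsimp; positivity⟩
    · simp only [Fin.reduceFinMk, vecMul_X_three]
      exact ⟨by dsimp; positivity, by dsimp; positivity⟩

/-- The relation φ² = φ + 1 turns the lengths for (x, y) X_m into nonnegative integer combinations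
of x, φx, y, φy, and 1 < φ < 2 gives the inequalities of the four linear lemmas. -/
lemma goldenExchange_induces (m : Fin 4) {x y : ℝ} (hx : 0 < x) (hy : 0 ≤ y) :
    ∃ s o, (goldenExchange ((![x, y] ᵥ* X m) 0) ((![x, y] ᵥ* X m) 1)).Induces
      (goldenExchange x y) s o := by
  have h1 := Real.one_lt_goldenRatio.le
  have h2 := Real.goldenRatio_lt_two.le
  have hx1 : x ≤ φ * x := by nlinarith
  have hy1 : y ≤ φ * y := by nlinarith
  have hy2 : φ * y ≤ 2 * y := by nlinarith
  have hφ (z : ℝ) : φ * (φ * z) = φ * z + z := by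
    rw [← mul_assoc, goldenRatio_mul_self]; ring
  fin_cases m
  · rw [show goldenExchange _ _ =
        exchange (φ * y) (x + φ * y) y (φ * x + φ * y + y) by
      simp only [Fin.zero_eta, vecMul_X_zero, goldenExchange,
        Matrix.cons_val_zero, Matrix.cons_val_one, mul_add, hφ]
      congr 1 <;> ring]
    exact ⟨_, _, induces_zero hx hy hx1 hy1 hy2⟩
  · rw [show goldenExchange _ _ =
        exchange (φ * x + φ * y + y) (φ * x + φ * y) (x + φ * y) (φ * x + x + φ * y + y) by
      simp only [Fin.mk_one, vecMul_X_one, goldenExchange,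
        Matrix.cons_val_zero, Matrix.cons_val_one, mul_add, hφ]
      congr 1 <;> ring]
    exact ⟨_, _, induces_one hx hy hx1 hy1 hy2⟩
  · rw [show goldenExchange _ _ =
        exchange (φ * x + x + φ * y + y) (φ * x + y) (φ * x + φ * y) (φ * x + x + φ * y) by
      simp only [Fin.reduceFinMk, vecMul_X_two, goldenExchange,
        Matrix.cons_val_zero, Matrix.cons_val_one, mul_add, hφ]
      congr 1 <;> ring]
    exact ⟨_, _, induces_two hx hy hx1 hy1 hy2⟩
  · rw [show goldenExchange _ _ =
        exchange (φ * x + x + φ * y) x (φ * x + y) (φ * x) by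
      simp only [Fin.reduceFinMk, vecMul_X_three, goldenExchange,
        Matrix.cons_val_zero, Matrix.cons_val_one, mul_add, hφ]]
    exact ⟨_, _, induces_three hx hy hx1 hy1 hy2⟩

/-- With second coordinate 0 the first and third intervals degenerate and the other two have
translation 0, so each is a cylinder of period 1. -/
lemma isDecomposition_base {w : ℝ} (hw : 0 < w) :
    (goldenExchange w 0).IsDecomposition w (φ * w) 0 [1] w [3] := by
  have hφ : 0 < φ * w := mul_pos Real.goldenRatio_pos hw
  refine ⟨⟨?_, ?_, ?_⟩, ⟨?_, ?_, ?_⟩, ?_, ?_⟩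
  · simp [Fits, goldenExchange, exchange]
  · simp [goldenExchange, exchange]
  · intro k hk
    simpa using hk 1
  · simp [Fits, goldenExchange, exchange]
  · simp [goldenExchange, exchange]
  · intro k hk
    simpa using hk 3
  · intro i
    fin_cases i <;> simp [goldenExchange, exchange]
  · intro i z hi h1 h2
    fin_cases i <;> simp [goldenExchange, exchange] at hi h1 h2
    · exact Or.inl ⟨[], [], rfl, by simpa, by simpa⟩
    · exact Or.inr ⟨[], [], rfl, by simpa, by simpa⟩

lemma exists_isDecomposition {k : ℕ} (n : Fin k → Fin 4) {w : ℝ} (hw : 0 < w) :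
    ∃ p₁ c₁ p₂ c₂, (goldenExchange (w * ray n 0) (w * ray n 1)).IsDecomposition
      w (φ * w) p₁ c₁ p₂ c₂ := by
  have hφ : 0 < φ * w := mul_pos Real.goldenRatio_pos hw
  induction k with
  | zero => exact ⟨0, [1], w, [3], by simpa [ray_zero] using isDecomposition_base hw⟩
  | succ k ih =>
    obtain ⟨p₁, c₁, p₂, c₂, h⟩ := ih fun i => n i.succ
    obtain ⟨h0, h1⟩ := ray_nonneg fun i => n i.succ
    obtain ⟨s, o, hs⟩ := goldenExchange_induces (n 0) (mul_pos hw h0) (mul_nonneg hw.le h1)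
    have hray (i : Fin 2) : (![w * ray (fun i => n i.succ) 0, w * ray (fun i => n i.succ) 1] ᵥ*
        X (n 0)) i = w * ray n i := by
      rw [ray_succ]
      simp [Matrix.vecMul, dotProduct, Fin.sum_univ_two]
      ring
    rw [hray, hray] at hs
    exact ⟨_, _, _, _, hs.isDecomposition hw.le hφ.le h⟩

/-- The strips of the interval exchange, with their periods. -/
lemma exists_isStrip {k : ℕ} (n : Fin k → Fin 4) {w : ℝ} (hw : 0 < w) :
    ∃ (a A : ℕ) (g₁ g₂ : ℤ → Fin 4) (q₁ q₂ : ℤ → ℝ),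
      (goldenExchange (w * ray n 0) (w * ray n 1)).IsStrip w a g₁ q₁ ∧
      (goldenExchange (w * ray n 0) (w * ray n 1)).IsStrip (φ * w) A g₂ q₂ ∧
      IsLeast {r : ℕ | 0 < r ∧ ∀ m : ℤ, g₁ (m + r) = g₁ m} a ∧
      IsLeast {r : ℕ | 0 < r ∧ ∀ m : ℤ, g₂ (m + r) = g₂ m} A ∧
      (¬ ∃ j : ℤ, ∀ m, g₁ (m + j) = g₂ m) ∧
      (∀ i z, (goldenExchange (w * ray n 0) (w * ray n 1)).lo i < z →
        z < (goldenExchange (w * ray n 0) (w * ray n 1)).hi i →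
        (∃ m, q₁ m ≤ z ∧ z ≤ q₁ m + w) ∨ (∃ m, q₂ m ≤ z ∧ z ≤ q₂ m + φ * w)) ∧
      a ≤ A ∧ (a : ℝ) + φ * A = φ ^ 2 * (ray n 0 + ray n 1) := by
  obtain ⟨p₁, c₁, p₂, c₂, h⟩ := exists_isDecomposition n hw
  obtain ⟨hr0, hr1⟩ := ray_nonneg n
  obtain ⟨g₁, q₁, h₁, hc₁, hm₁⟩ := h.cyl₁.exists_isStrip
  obtain ⟨g₂, q₂, h₂, hc₂, hm₂⟩ := h.cyl₂.exists_isStrip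
  have hg₁ := isLeast_period h₁.pos h₁.periodic_letter (by simpa only [hc₁] using h.cyl₁.primitive)
  have hg₂ := isLeast_period h₂.pos h₂.periodic_letter (by simpa only [hc₂] using h.cyl₂.primitive)
  have hlen : ∀ c : List (Fin 4), c.length = c.count 0 + c.count 1 + c.count 2 + c.count 3 := by
    intro c
    induction c with
    | nil => simp
    | cons i c ih => fin_cases i <;> simp [ih] <;> ring
  have l0 : φ * ray n 1 = c₁.count 0 + φ * c₂.count 0 := by
    have := h.length_eq 0
    simp [goldenExchange, exchange] at this
    exact mul_left_cancel₀ hw.ne' (by linarith)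
  have l1 : ray n 0 = c₁.count 1 + φ * c₂.count 1 := by
    have := h.length_eq 1
    simp [goldenExchange, exchange] at this
    exact mul_left_cancel₀ hw.ne' (by linarith)
  have l2 : ray n 1 = c₁.count 2 + φ * c₂.count 2 := by
    have := h.length_eq 2
    simp [goldenExchange, exchange] at this
    exact mul_left_cancel₀ hw.ne' (by linarith)
  have l3 : φ * ray n 0 = c₁.count 3 + φ * c₂.count 3 := by
    have := h.length_eq 3
    simp [goldenExchange, exchange] at this
    exact mul_left_cancel₀ hw.ne' (by linarith)
  have hφ := goldenRatio_mul_self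
  -- The last interval is φ times as long as the second, and φ(p + φq) = q + φ(p + q); comparing
  -- coefficients expresses the counts of 3 by those of 1. The counts of 0 and 2 are related
  -- likewise.
  have e1 : c₁.count 3 = c₂.count 1 ∧ c₂.count 3 = c₁.count 1 + c₂.count 1 := by
    have := eq_and_eq_of_add_goldenRatio_mul_eq (a := c₁.count 3) (b := c₂.count 3)
      (c := c₂.count 1) (d := c₁.count 1 + c₂.count 1) (by
        push_cast
        rw [← l3, l1]
        linear_combination (c₂.count 1 : ℝ) * hφ)
    exact_mod_cast this
  have e2 : c₁.count 0 = c₂.count 2 ∧ c₂.count 0 = c₁.count 2 + c₂.count 2 := by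
    have := eq_and_eq_of_add_goldenRatio_mul_eq (a := c₁.count 0) (b := c₂.count 0)
      (c := c₂.count 2) (d := c₁.count 2 + c₂.count 2) (by
        push_cast
        rw [← l0, l2]
        linear_combination (c₂.count 2 : ℝ) * hφ)
    exact_mod_cast this
  refine ⟨c₁.length, c₂.length, g₁, g₂, q₁, q₂, h₁, h₂, hg₁, hg₂, ?_, ?_, ?_, ?_⟩
  · rintro ⟨j, hj⟩
    have hset : {r : ℕ | 0 < r ∧ ∀ m : ℤ, g₁ (m + r) = g₁ m} =
        {r : ℕ | 0 < r ∧ ∀ m : ℤ, g₂ (m + r) = g₂ m} := by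
      ext r
      simp only [Set.mem_ofPred_eq, ← hj]
      refine and_congr_right fun _ => ⟨fun h m => ?_, fun h m => ?_⟩
      · rw [← h (m + j)]
        ring_nf
      · have := h (m - j)
        rw [sub_add_cancel] at this
        rw [← this]
        ring_nf
    rw [hset] at hg₁
    have hN := hg₁.unique hg₂
    have hcount : ∀ i, c₁.count i = c₂.count i := by
      intro i
      rw [← hc₁, ← hc₂, ← count_shift h₁.periodic_letter i j, hN]
      simp only [hj]
    have := hcount 0
    have := hcount 1
    have := hcount 2
    have := hcount 3
    -- Equal counts p = q of the letter 1 in both words would give q = p + q by `e1`, hence p = q =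
    -- 0, but the second interval has positive length.
    have hz : c₁.count 1 = 0 := by omega
    have hz' : c₂.count 1 = 0 := by omega
    rw [l1, hz, hz'] at hr0
    simp at hr0
  · intro i z h1 h2
    exact (h.cover i z (h1.trans h2) h1.le h2.le).imp (hm₁ i z) (hm₂ i z)
  -- By `e1` and `e2`, A - a is the number of letters 1 and 2 in `c₂`.
  · rw [hlen, hlen]
    omega
  · rw [hlen, hlen]
    push_cast
    linear_combination -l0 - l1 - l2 - l3 - (ray n 0 + ray n 1) * hφ

/-! ### Directions in homogeneous coordinates -/

/-- The point `a / b` of the projective line. -/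
def quotient (a b : ℝ) : OnePoint ℝ := if b = 0 then ∞ else ((a / b : ℝ) : OnePoint ℝ)

lemma quotient_mul_left {c : ℝ} (hc : c ≠ 0) (a b : ℝ) :
    quotient (c * a) (c * b) = quotient a b := by
  simp only [quotient, mul_eq_zero, hc, false_or, mul_div_mul_left a b hc]

/-- The pair (0, 0) is excluded: `quotient` gives it the default value ∞, which `g` need not fix. -/
lemma smul_quotient (g : GL (Fin 2) ℝ) {a b : ℝ} (h : a ≠ 0 ∨ b ≠ 0) :
    g • quotient a b = quotient (g 0 0 * a + g 0 1 * b) (g 1 0 * a + g 1 1 * b) := by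
  by_cases hb : b = 0
  · have ha : a ≠ 0 := h.resolve_right (not_not.2 hb)
    simp only [quotient, hb, if_true, OnePoint.smul_infty_eq_ite, mul_zero, add_zero, mul_eq_zero,
      ha, or_false, mul_div_mul_right _ _ ha]
  · have e1 : g 1 0 * (a / b) + g 1 1 = (g 1 0 * a + g 1 1 * b) / b := by field_simp
    have e2 : g 0 0 * (a / b) + g 0 1 = (g 0 0 * a + g 0 1 * b) / b := by field_simp
    simp only [quotient, hb, if_false, OnePoint.smul_some_eq_ite]
    rw [e1, e2, div_div_div_cancel_right₀ hb]
    simp only [div_eq_zero_iff, hb, or_false]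

/-- The direction with the homogeneous coordinates `r : s`, of which the sector of directions
between the diagonals `1 - φ / 2` and `φ / 2 - 1` consists of those with `0 ≤ r, s`. -/
def sectorPoint (r s : ℝ) : OnePoint ℝ := quotient (r - s) (2 * φ ^ 2 * (r + s))

lemma sectorPoint_ne {r s : ℝ} (h : r ≠ 0 ∨ s ≠ 0) : r - s ≠ 0 ∨ 2 * φ ^ 2 * (r + s) ≠ 0 := by
  by_contra! hc
  have h2 : r + s = 0 := by
    have : (2 * φ ^ 2 : ℝ) ≠ 0 := by positivity
    exact (mul_eq_zero.1 hc.2).resolve_left this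
  rcases h with h | h <;> apply h <;> linarith

/-- In these coordinates `T` is, up to the scalar 4, a matrix of determinant 1 and trace φ = 2 cos
36°, so it has order 5 on directions. -/
lemma T_smul_sectorPoint {r s : ℝ} (h : r ≠ 0 ∨ s ≠ 0) :
    T • sectorPoint r s = sectorPoint (φ * r + s) (-r) := by
  have hφ := goldenRatio_mul_self
  rw [sectorPoint, smul_quotient _ (sectorPoint_ne h)]
  refine Eq.trans ?_ (quotient_mul_left (c := 4) (by norm_num) _ _)
  congr 1
  · change 2 * φ * (r - s) + (3 - φ) * (2 * φ ^ 2 * (r + s)) = _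
    linear_combination (-2 * (r + s) * (φ - 2)) * hφ
  · change -4 * (r - s) + 2 * φ * (2 * φ ^ 2 * (r + s)) = _
    linear_combination (4 * (1 - φ) * (r - s)) * hφ

lemma R_smul_sectorPoint {r s : ℝ} (h : r ≠ 0 ∨ s ≠ 0) :
    R • sectorPoint r s = sectorPoint r (-s) := by
  rw [sectorPoint, smul_quotient _ (sectorPoint_ne h)]
  refine Eq.trans ?_ (quotient_mul_left (c := 2 * φ ^ 2) (by positivity) _ _)
  congr 1
  · change 0 * (r - s) + 1 * (2 * φ ^ 2 * (r + s)) = _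
    ring
  · change 4 * φ ^ 4 * (r - s) + 0 * (2 * φ ^ 2 * (r + s)) = _
    ring

/-- The exponents for a sequence of indices whose first index has number `e + 1`. -/
def shiftedExponent (e : ℕ) {k : ℕ} (n : Fin k → Fin 4) (i : Fin k) : ℕ :=
  if Even ((i : ℕ) + e + 1) then 4 - (n i : ℕ)
  else if (i : ℕ) + 1 = k then (n i : ℕ)
  else (n i : ℕ) + 1

lemma sectorPoint_one_zero : sectorPoint 1 0 = ((1 - φ / 2 : ℝ) : OnePoint ℝ) := by
  have hφ := goldenRatio_mul_self
  have h : (2 * φ ^ 2 * (1 + 0) : ℝ) ≠ 0 := by positivity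
  rw [sectorPoint, quotient, if_neg h]
  congr 1
  rw [div_eq_iff h]
  linear_combination (φ - 1) * hφ

lemma ray_ne {k : ℕ} (n : Fin k → Fin 4) : ray n 0 ≠ 0 ∨ ray n 1 ≠ 0 :=
  Or.inl (ray_nonneg n).1.ne'

lemma RT_smul_sectorPoint {r s : ℝ} (h : r ≠ 0 ∨ s ≠ 0) :
    (R * T) • sectorPoint r s = sectorPoint (φ * r + s) r ∧
    (R * T ^ 2) • sectorPoint r s = sectorPoint (φ * r + φ * s) (φ * r + s) ∧
    (R * T ^ 3) • sectorPoint r s = sectorPoint (r + φ * s) (φ * r + φ * s) ∧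
    (R * T ^ 4) • sectorPoint r s = sectorPoint s (r + φ * s) := by
  have hφ := goldenRatio_mul_self
  have ne : ∀ {r s : ℝ}, (r ≠ 0 ∨ s ≠ 0) → (φ * r + s ≠ 0 ∨ -r ≠ 0) := by
    intro r s h
    by_contra! hc
    have hr : r = 0 := by linarith [hc.2]
    subst hr
    have := hc.1
    simp_all
  have h2 : T ^ 2 • sectorPoint r s = sectorPoint (φ * r + φ * s) (-(φ * r + s)) := by
    rw [sq, mul_smul, T_smul_sectorPoint h, T_smul_sectorPoint (ne h)]
    congr 1
    linear_combination r * hφ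
  have n2 : φ * r + φ * s ≠ 0 ∨ -(φ * r + s) ≠ 0 := by
    convert ne (ne h) using 2
    linear_combination -r * hφ
  have h3 : T ^ 3 • sectorPoint r s = sectorPoint (r + φ * s) (-(φ * r + φ * s)) := by
    rw [pow_succ', mul_smul, h2, T_smul_sectorPoint n2]
    congr 1
    linear_combination (r + s) * hφ
  have n3 : r + φ * s ≠ 0 ∨ -(φ * r + φ * s) ≠ 0 := by
    convert ne n2 using 2
    linear_combination -(r + s) * hφ
  have h4 : T ^ 4 • sectorPoint r s = sectorPoint s (-(r + φ * s)) := by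
    rw [pow_succ', mul_smul, h3, T_smul_sectorPoint n3]
    congr 1
    linear_combination s * hφ
  have n4 : s ≠ 0 ∨ -(r + φ * s) ≠ 0 := by
    convert ne n3 using 2
    linear_combination -s * hφ
  refine ⟨?_, ?_, ?_, ?_⟩
  · rw [mul_smul, T_smul_sectorPoint h, R_smul_sectorPoint (ne h), neg_neg]
  · rw [mul_smul, h2, R_smul_sectorPoint n2, neg_neg]
  · rw [mul_smul, h3, R_smul_sectorPoint n3, neg_neg]
  · rw [mul_smul, h4, R_smul_sectorPoint n4, neg_neg]

/-- This form for indices of even number interchanges the coordinates; the next one, for odd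
numbers, starts from interchanged coordinates and restores the order. -/
lemma RT_pow_smul_sectorPoint {r s : ℝ} (h : r ≠ 0 ∨ s ≠ 0) (m : Fin 4) :
    (R * T ^ (4 - (m : ℕ))) • sectorPoint r s =
      sectorPoint ((![r, s] ᵥ* X m) 1) ((![r, s] ᵥ* X m) 0) := by
  obtain ⟨h1, h2, h3, h4⟩ := RT_smul_sectorPoint h
  fin_cases m
  · simpa [vecMul_X_zero] using h4
  · simpa [vecMul_X_one] using h3
  · simpa [vecMul_X_two] using h2
  · simpa [vecMul_X_three] using h1

lemma RT_pow_smul_sectorPoint_swap {r s : ℝ} (h : r ≠ 0 ∨ s ≠ 0) (m : Fin 4) :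
    (R * T ^ ((m : ℕ) + 1)) • sectorPoint s r =
      sectorPoint ((![r, s] ᵥ* X m) 0) ((![r, s] ᵥ* X m) 1) := by
  obtain ⟨h1, h2, h3, h4⟩ := RT_smul_sectorPoint h.symm
  fin_cases m
  · simpa [vecMul_X_zero, add_comm] using h1
  · simpa [vecMul_X_one, add_comm] using h2
  · simpa [vecMul_X_two, add_comm] using h3
  · simpa [vecMul_X_three, add_comm] using h4

/-- The induction removes the first index, which flips the parity of `e` and thereby the order of
the coordinates. The empty product gives 1 : 0, which is in the wrong order for odd `e`; hence the
condition `hk`. -/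
lemma prod_shiftedExponent_smul (e : ℕ) {k : ℕ} (n : Fin k → Fin 4) (hk : Even e ∨ 0 < k) :
    (List.ofFn fun i => R * T ^ shiftedExponent e n i).prod • ((1 - φ / 2 : ℝ) : OnePoint ℝ) =
      if Even e then sectorPoint (ray n 0) (ray n 1) else sectorPoint (ray n 1) (ray n 0) := by
  rw [← sectorPoint_one_zero]
  induction k generalizing e with
  | zero => simp [ray_zero, hk.resolve_right (lt_irrefl 0)]
  | succ k ih =>
    have htail : ∀ i : Fin k, shiftedExponent e n i.succ =
        shiftedExponent (e + 1) (fun i => n i.succ) i := by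
      intro i
      simp only [shiftedExponent, Fin.val_succ, Nat.add_right_cancel_iff]
      congr 2
      ring_nf
    have hvec : ![ray (fun i => n i.succ) 0, ray (fun i => n i.succ) 1] =
        ray (fun i => n i.succ) := by
      ext i; fin_cases i <;> rfl
    rw [List.ofFn_succ, List.prod_cons, mul_smul]
    simp only [htail]
    by_cases he : Even e
    · have he1 : ¬ Even (e + 1) := by simpa [Nat.even_add_one] using he
      rw [if_pos he]
      have h := RT_pow_smul_sectorPoint_swap (ray_ne fun i => n i.succ) (n 0)
      rw [hvec, ← ray_succ] at h
      rw [← h]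
      rcases Nat.eq_zero_or_pos k with rfl | hk
      · simp only [shiftedExponent, Fin.val_zero, zero_add, he1, if_false, if_true,
          List.ofFn_zero, List.prod_nil, one_smul, ray_zero]
        -- A last index of odd number needs the start 0 : 1 instead of 1 : 0. Since T(0 : 1) = 1 :
        -- 0, this costs one factor `T`, which is why its exponent is n_k and not n_k + 1.
        rw [pow_succ, ← mul_assoc, mul_smul (R * T ^ _) T]
        congr 1
        simpa using (T_smul_sectorPoint (r := 0) (s := 1) (by simp)).symm
      · rw [ih (e + 1) _ (Or.inr hk), if_neg he1]
        simp only [shiftedExponent, Fin.val_zero, zero_add, he1, if_false]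
        rw [if_neg (by omega)]
    · have he1 : Even (e + 1) := by simpa [Nat.even_add_one] using he
      rw [if_neg he, ih (e + 1) _ (Or.inl he1), if_pos he1]
      have h := RT_pow_smul_sectorPoint (ray_ne fun i => n i.succ) (n 0)
      rw [hvec, ← ray_succ] at h
      rw [← h]
      simp only [shiftedExponent, Fin.val_zero, zero_add, he1, if_true]

lemma alpha_eq_sectorPoint {k : ℕ} (n : Fin k → Fin 4) :
    alpha n = sectorPoint (ray n 0) (ray n 1) := by
  have := prod_shiftedExponent_smul 0 n (Or.inl (by simp))
  rw [if_pos (by simp)] at this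
  rw [← this]
  rfl

lemma direction_alpha {k : ℕ} (n : Fin k → Fin 4) :
    direction (alpha n) = ((ray n 0 - ray n 1) / (2 * φ ^ 2 * (ray n 0 + ray n 1)),
      Real.sin (Real.pi / 5)) := by
  obtain ⟨h0, h1⟩ := ray_nonneg n
  have h : (2 * φ ^ 2 * (ray n 0 + ray n 1) : ℝ) ≠ 0 := by positivity
  rw [alpha_eq_sectorPoint, sectorPoint, quotient, if_neg h]
  rfl

/-! ### The geometry of the pentagon -/

lemma sin_pi_div_five_pos : 0 < Real.sin (Real.pi / 5) :=
  Real.sin_pos_of_pos_of_lt_pi (by positivity) (by linarith [Real.pi_pos])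

/-- The affine function that vanishes on the `k`-th side and is positive inside the pentagon. -/
def sideForm (k : Fin 5) (p : ℝ × ℝ) : ℝ :=
  let s := Real.sin (Real.pi / 5)
  (![φ * s, 0, -(φ * s), -s, s] : Fin 5 → ℝ) k * p.1 +
  (![(φ - 1) / 2, 1, (φ - 1) / 2, -(φ / 2), -(φ / 2)] : Fin 5 → ℝ) k * p.2 +
  (![0, φ * s, φ ^ 2 * s, φ * s, 0] : Fin 5 → ℝ) k

/-- The values are the heights of the vertices over the side; by rotational symmetry they depend
only on j - k. -/
lemma sideForm_vertex (k j : Fin 5) :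
    sideForm k (vertex j) =
      Real.sin (Real.pi / 5) * (![0, 0, φ, φ + 1, φ] : Fin 5 → ℝ) (j - k) := by
  have hφ := goldenRatio_mul_self
  unfold sideForm vertex
  generalize Real.sin (Real.pi / 5) = s
  generalize φ = f at *
  fin_cases k <;> fin_cases j <;> simp <;>
  first
  | ring1
  | linear_combination (s / 2) * hφ
  | linear_combination s * hφ

lemma exists_of_mem_side {p : ℝ × ℝ} {j : Fin 5} (hp : p ∈ side j) :
    ∃ A B : ℝ, 0 < A ∧ 0 < B ∧ A + B = 1 ∧ p = A • vertex j + B • vertex (j + 1) := by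
  obtain ⟨A, B, hA, hB, hAB, h⟩ := hp
  exact ⟨A, B, hA, hB, hAB, h.symm⟩

lemma sideForm_combination (k : Fin 5) {A B : ℝ} (h : A + B = 1) (p q : ℝ × ℝ) :
    sideForm k (A • p + B • q) = A * sideForm k p + B * sideForm k q := by
  simp only [sideForm, Prod.fst_add, Prod.snd_add, Prod.smul_fst, Prod.smul_snd, smul_eq_mul]
  obtain rfl : B = 1 - A := by linarith
  ring

lemma sideForm_eq_zero {p : ℝ × ℝ} {k : Fin 5} (hp : p ∈ side k) : sideForm k p = 0 := by
  obtain ⟨A, B, hA, hB, hAB, rfl⟩ := exists_of_mem_side hp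
  rw [sideForm_combination k hAB, sideForm_vertex, sideForm_vertex]
  simp

lemma sideForm_pos {p : ℝ × ℝ} {j k : Fin 5} (hp : p ∈ side j) (hjk : j ≠ k) :
    0 < sideForm k p := by
  obtain ⟨A, B, hA, hB, hAB, rfl⟩ := exists_of_mem_side hp
  rw [sideForm_combination k hAB, sideForm_vertex, sideForm_vertex, add_sub_right_comm]
  have hs := sin_pi_div_five_pos
  have hφ := Real.goldenRatio_pos
  have hjk' : j - k ≠ 0 := sub_ne_zero.2 hjk
  generalize j - k = i at *
  fin_cases i
  · exact absurd rfl hjk'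
  all_goals
    simp
    positivity

/-- This is the half-turn about the midpoint of the side. It describes a crossing followed by the
identification of P' with P by -1. -/
lemma shift_sub_mem_side {p : ℝ × ℝ} {j : Fin 5} (hp : p ∈ side j) : shift j - p ∈ side j := by
  obtain ⟨A, B, hA, hB, hAB, rfl⟩ := exists_of_mem_side hp
  refine ⟨B, A, hB, hA, by linarith, ?_⟩
  obtain rfl : B = 1 - A := by linarith
  simp only [shift, sub_smul, one_smul]
  abel

/-- The projection to the horizontal axis along the direction `(u, sin 36°)`. -/
def proj (u : ℝ) : ℝ × ℝ →ₗ[ℝ] ℝ :=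
  LinearMap.fst ℝ ℝ ℝ - (u / Real.sin (Real.pi / 5)) • LinearMap.snd ℝ ℝ ℝ

lemma proj_apply (u : ℝ) (p : ℝ × ℝ) : proj u p = p.1 - u / Real.sin (Real.pi / 5) * p.2 := rfl

/-- The directions in the sector, by the coordinate and by the homogeneous coordinates. -/
structure IsSector (u x y : ℝ) : Prop where
  left_nonneg : 0 ≤ x
  right_nonneg : 0 ≤ y
  left_eq : x = (φ - 1) / 2 + φ * u
  right_eq : y = (φ - 1) / 2 - φ * u

/-- The projections of the vertices. -/
def projVertex (x y : ℝ) : Fin 5 → ℝ := ![0, x, x + 1, φ, φ * y + x]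

/-- The increments of the functions `sideForm`, up to a positive factor. -/
def slope (x y : ℝ) : Fin 5 → ℝ := ![x, 1, y, -(φ * x + y), -(φ * y + x)]

namespace IsSector

variable {u x y : ℝ}

lemma add_eq (h : IsSector u x y) : x + y = φ - 1 := by rw [h.left_eq, h.right_eq]; ring

lemma mul_add_eq (h : IsSector u x y) : φ * x + φ * y = 1 := by
  rw [← mul_add, h.add_eq]
  linear_combination goldenRatio_mul_self

lemma mul_left_nonneg (h : IsSector u x y) : 0 ≤ φ * x :=
  mul_nonneg Real.goldenRatio_pos.le h.left_nonneg

lemma mul_right_nonneg (h : IsSector u x y) : 0 ≤ φ * y :=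
  mul_nonneg Real.goldenRatio_pos.le h.right_nonneg

lemma pos_left (h : IsSector u x y) : 0 < φ * x + y := by
  have := h.add_eq
  have := h.mul_left_nonneg
  have := h.left_nonneg
  have := h.right_nonneg
  have := Real.one_lt_goldenRatio
  rcases h.left_nonneg.eq_or_lt with hx | hx
  · linarith
  · have := mul_pos Real.goldenRatio_pos hx
    linarith

lemma pos_right (h : IsSector u x y) : 0 < φ * y + x := by
  have := h.add_eq
  have := h.mul_right_nonneg
  have := h.left_nonneg
  have := h.right_nonneg
  have := Real.one_lt_goldenRatio
  rcases h.right_nonneg.eq_or_lt with hx | hx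
  · linarith
  · have := mul_pos Real.goldenRatio_pos hx
    linarith

lemma proj_direction (u t : ℝ) : proj u (t • (u, Real.sin (Real.pi / 5))) = 0 := by
  have := sin_pi_div_five_pos.ne'
  simp [proj_apply]
  field_simp
  simp

lemma proj_vertex (h : IsSector u x y) (j : Fin 5) : proj u (vertex j) = projVertex x y j := by
  have hs := sin_pi_div_five_pos.ne'
  have hφ := goldenRatio_mul_self
  rw [proj_apply]
  have e : ∀ c, u / Real.sin (Real.pi / 5) * (c * Real.sin (Real.pi / 5)) = u * c := by
    intro c; field_simp
  have e1 := e φ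
  have e2 := e 1
  rw [one_mul] at e2
  have h1 := h.left_eq
  have h2 := h.right_eq
  fin_cases j <;> simp [vertex, projVertex, e1, e2]
  · linarith
  · linarith
  · rw [h1, h2]
    linear_combination (-1 / 2 + u) * hφ

lemma sideForm_add (h : IsSector u x y) (k : Fin 5) (p : ℝ × ℝ) (t : ℝ) :
    sideForm k (p + t • (u, Real.sin (Real.pi / 5))) =
      sideForm k p + t * (Real.sin (Real.pi / 5) * slope x y k) := by
  have hφ := goldenRatio_mul_self
  have h1 := h.left_eq
  have h2 := h.right_eq
  generalize hs : Real.sin (Real.pi / 5) = s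
  have : (![φ * s, 0, -(φ * s), -s, s] : Fin 5 → ℝ) k * u +
      (![(φ - 1) / 2, 1, (φ - 1) / 2, -(φ / 2), -(φ / 2)] : Fin 5 → ℝ) k * s =
      s * slope x y k := by
    rw [h1, h2]
    fin_cases k <;> simp [slope]
    · ring
    · ring
    · linear_combination (s / 2 + s * u) * hφ
    · linear_combination (s / 2 - s * u) * hφ
  simp only [sideForm, hs, Prod.fst_add, Prod.snd_add, Prod.smul_fst, Prod.smul_snd, smul_eq_mul]
  linear_combination t * this

/-- A chord in the direction of the sector enters through a lower side and leaves through an upper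
side. -/
lemma slope_of_chord (h : IsSector u x y) {i j : Fin 5} {p q : ℝ × ℝ} {t : ℝ} (hp : p ∈ side i)
    (hq : q ∈ side j) (hij : i ≠ j) (ht : 0 < t) (hpq : q = p + t • (u, Real.sin (Real.pi / 5))) :
    0 < slope x y i ∧ slope x y j < 0 := by
  have hs := sin_pi_div_five_pos
  have e1 := h.sideForm_add i p t
  have e2 := h.sideForm_add j p t
  rw [← hpq, sideForm_eq_zero hp] at e1
  rw [← hpq, sideForm_eq_zero hq] at e2
  have f1 := sideForm_pos hq hij.symm
  have f2 := sideForm_pos hp hij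
  have hts := mul_pos ht hs
  constructor
  · by_contra! hc
    have := mul_nonpos_of_nonneg_of_nonpos hts.le hc
    linarith
  · by_contra! hc
    have := mul_nonneg hts.le hc
    linarith

lemma eq_add_of_proj_eq {p q : ℝ × ℝ} (hpq : proj u p = proj u q) :
    q = p + ((q.2 - p.2) / Real.sin (Real.pi / 5)) • (u, Real.sin (Real.pi / 5)) := by
  have hs := sin_pi_div_five_pos.ne'
  rw [proj_apply, proj_apply] at hpq
  ext
  · simp
    field_simp at hpq ⊢
    linarith
  · simp
    field_simp
    ring

lemma eq_of_mem_side (h : IsSector u x y) {j : Fin 5} {p q : ℝ × ℝ} (hp : p ∈ side j)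
    (hq : q ∈ side j) (hj : slope x y j ≠ 0) (hpq : proj u p = proj u q) : p = q := by
  have e := eq_add_of_proj_eq hpq
  have := h.sideForm_add j p ((q.2 - p.2) / Real.sin (Real.pi / 5))
  rw [← e, sideForm_eq_zero hp, sideForm_eq_zero hq, zero_add, eq_comm, mul_eq_zero] at this
  rw [this.resolve_right (mul_ne_zero sin_pi_div_five_pos.ne' hj)] at e
  simpa using e.symm

lemma proj_shift (h : IsSector u x y) (j : Fin 5) :
    proj u (shift j) = projVertex x y j + projVertex x y (j + 1) := by
  rw [shift, map_add, h.proj_vertex, h.proj_vertex]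

lemma proj_mem_Ioo (h : IsSector u x y) {j : Fin 5} {p : ℝ × ℝ} (hp : p ∈ side j)
    (hj : projVertex x y j < projVertex x y (j + 1)) :
    projVertex x y j < proj u p ∧ proj u p < projVertex x y (j + 1) := by
  obtain ⟨A, B, hA, hB, hAB, rfl⟩ := exists_of_mem_side hp
  rw [map_add, map_smul, map_smul, h.proj_vertex, h.proj_vertex, smul_eq_mul, smul_eq_mul]
  obtain rfl : B = 1 - A := by linarith
  constructor <;> nlinarith

lemma proj_mem_Ioo' (h : IsSector u x y) {j : Fin 5} {p : ℝ × ℝ} (hp : p ∈ side j)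
    (hj : projVertex x y (j + 1) < projVertex x y j) :
    projVertex x y (j + 1) < proj u p ∧ proj u p < projVertex x y j := by
  obtain ⟨A, B, hA, hB, hAB, rfl⟩ := exists_of_mem_side hp
  rw [map_add, map_smul, map_smul, h.proj_vertex, h.proj_vertex, smul_eq_mul, smul_eq_mul]
  obtain rfl : B = 1 - A := by linarith
  constructor <;> nlinarith

lemma exists_mem_side (h : IsSector u x y) {j : Fin 5} {z : ℝ}
    (hz : (projVertex x y j < z ∧ z < projVertex x y (j + 1)) ∨
      (projVertex x y (j + 1) < z ∧ z < projVertex x y j)) : ∃ p ∈ side j, proj u p = z := by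
  have key : ∀ A B : ℝ, 0 < A → 0 < B → A + B = 1 →
      A * projVertex x y j + B * projVertex x y (j + 1) = z → ∃ p ∈ side j, proj u p = z := by
    intro A B hA hB hAB hz
    refine ⟨A • vertex j + B • vertex (j + 1), ⟨A, B, hA, hB, hAB, rfl⟩, ?_⟩
    rw [map_add, map_smul, map_smul, h.proj_vertex, h.proj_vertex, smul_eq_mul, smul_eq_mul, hz]
  generalize projVertex x y j = a at *
  generalize projVertex x y (j + 1) = b at *
  rcases hz with ⟨h1, h2⟩ | ⟨h1, h2⟩
  · have hab : b - a ≠ 0 := by linarith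
    exact key ((b - z) / (b - a)) ((z - a) / (b - a)) (div_pos (by linarith) (by linarith))
      (div_pos (by linarith) (by linarith)) (by field_simp; ring) (by field_simp; ring)
  · have hab : a - b ≠ 0 := by linarith
    exact key ((z - b) / (a - b)) ((a - z) / (a - b)) (div_pos (by linarith) (by linarith))
      (div_pos (by linarith) (by linarith)) (by field_simp; ring) (by field_simp; ring)

end IsSector

lemma snd_pos_of_mem_side {j : Fin 5} (hj : j = 3 ∨ j = 4) {p : ℝ × ℝ} (hp : p ∈ side j) :
    0 < p.2 := by
  obtain ⟨A, B, hA, hB, hAB, rfl⟩ := exists_of_mem_side hp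
  have hs := sin_pi_div_five_pos
  rcases hj with rfl | rfl <;> simp [vertex] <;> positivity

lemma snd_neg_of_mem_side {j : Fin 5} (hj : j = 0 ∨ j = 1 ∨ j = 2) {p : ℝ × ℝ} (hp : p ∈ side j) :
    p.2 < 0 := by
  obtain ⟨A, B, hA, hB, hAB, rfl⟩ := exists_of_mem_side hp
  have hs := mul_pos Real.goldenRatio_pos sin_pi_div_five_pos
  have h1 := mul_pos hA hs
  have h2 := mul_pos hB hs
  rcases hj with rfl | rfl | rfl <;> simp [vertex] <;> linarith

/-- The horizontal diagonal separates the lower sides from the upper ones, so the time is positive.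
-/
lemma exists_chord {u : ℝ} {i j : Fin 5} (hi : i = 0 ∨ i = 1 ∨ i = 2) (hj : j = 3 ∨ j = 4)
    {p q : ℝ × ℝ} (hp : p ∈ side i) (hq : q ∈ side j) (hpq : proj u p = proj u q) :
    ∃ t : ℝ, 0 < t ∧ q = p + t • (u, Real.sin (Real.pi / 5)) :=
  ⟨_, div_pos (by linarith [snd_pos_of_mem_side hj hq, snd_neg_of_mem_side hi hp])
    sin_pi_div_five_pos, IsSector.eq_add_of_proj_eq hpq⟩

open IntervalExchange

/-! ### Trajectories as orbits of the interval exchange -/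

/-- The pair of sides that is crossed by the trajectories through an exchanged interval. -/
def letterPair : Fin 4 → Fin 5 × Fin 5 := ![(4, 1), (4, 0), (3, 2), (3, 1)]

lemma letterPair_injective : Function.Injective letterPair := by decide

lemma sgn_even {n : ℤ} (h : Even n) : sgn n = 1 := if_pos h

lemma sgn_odd {n : ℤ} (h : ¬ Even n) : sgn n = -1 := if_neg h

namespace IsSector

variable {u x y : ℝ}

lemma slope_pos_iff (h : IsSector u x y) {i : Fin 5} (hi : 0 < slope x y i) :
    (i = 0 ∧ 0 < x) ∨ i = 1 ∨ (i = 2 ∧ 0 < y) := by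
  have := h.pos_left
  have := h.pos_right
  fin_cases i <;> simp [slope] at hi ⊢
  · exact hi
  · exact hi
  · linarith
  · linarith

lemma slope_neg_iff (h : IsSector u x y) {i : Fin 5} (hi : slope x y i < 0) : i = 3 ∨ i = 4 := by
  have := h.left_nonneg
  have := h.right_nonneg
  fin_cases i <;> simp [slope] at hi ⊢ <;> linarith

/-- The sides of a crossed pair and the projections of the crossing points determine an exchanged
interval. -/
lemma exists_letter (h : IsSector u x y) {i j : Fin 5} {p q : ℝ × ℝ} (hp : p ∈ side i)
    (hq : q ∈ side j) (hi : 0 < slope x y i) (hj : slope x y j < 0)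
    (hpq : proj u p = proj u (shift j - q)) :
    ∃ l, letterPair l = (j, i) ∧ (goldenExchange x y).lo l < proj u q ∧
      proj u q < (goldenExchange x y).hi l ∧
      (goldenExchange x y).t l = proj u (shift i) - proj u (shift j) := by
  have h1 := h.mul_add_eq
  have h2 := h.add_eq
  have h3 := h.left_nonneg
  have h4 := h.right_nonneg
  have h5 := h.mul_left_nonneg
  have h6 := h.mul_right_nonneg
  have h7 := h.pos_left
  have h8 := h.pos_right
  rw [map_sub] at hpq
  rw [h.proj_shift] at hpq ⊢
  rw [h.proj_shift]
  have hq' : (j = 3 → φ * y + x < proj u q ∧ proj u q < φ) ∧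
      (j = 4 → 0 < proj u q ∧ proj u q < φ * y + x) := by
    constructor <;> rintro rfl
    · simpa [projVertex] using h.proj_mem_Ioo' hq (by simp [projVertex]; linarith)
    · simpa [projVertex] using h.proj_mem_Ioo' hq (by simp [projVertex]; linarith)
  -- If x = 0 or y = 0, side 0 or side 2 is parallel to the direction and projects to a point; no
  -- chord enters there.
  have hp' : (i = 0 → 0 < x → 0 < proj u p ∧ proj u p < x) ∧
      (i = 1 → x < proj u p ∧ proj u p < x + 1) ∧
      (i = 2 → 0 < y → x + 1 < proj u p ∧ proj u p < φ) := by
    refine ⟨?_, ?_, ?_⟩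
    · rintro rfl hx
      simpa [projVertex] using h.proj_mem_Ioo hp (by simpa [projVertex])
    · rintro rfl
      simpa [projVertex] using h.proj_mem_Ioo hp (by simp [projVertex])
    · rintro rfl hy
      simpa [projVertex] using h.proj_mem_Ioo hp (by simp [projVertex]; linarith)
  -- Of the six pairs, (3, 0) and (4, 2) are impossible because the reflected projection of one side
  -- misses that of the other.
  rcases h.slope_neg_iff hj with rfl | rfl <;>
    rcases h.slope_pos_iff hi with ⟨rfl, hx⟩ | rfl | ⟨rfl, hy⟩
  · have := hq'.1 rfl
    have := hp'.1 rfl hx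
    simp [projVertex] at hpq
    linarith
  · have := hq'.1 rfl
    have := hp'.2.1 rfl
    simp [projVertex] at hpq ⊢
    refine ⟨3, rfl, ?_, ?_, ?_⟩ <;> simp [goldenExchange, exchange] <;> linarith
  · have := hq'.1 rfl
    have := hp'.2.2 rfl hy
    simp [projVertex] at hpq ⊢
    refine ⟨2, rfl, ?_, ?_, ?_⟩ <;> simp [goldenExchange, exchange] <;> linarith
  · have := hq'.2 rfl
    have := hp'.1 rfl hx
    simp [projVertex] at hpq ⊢
    refine ⟨1, rfl, ?_, ?_, ?_⟩ <;> simp [goldenExchange, exchange] <;> linarith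
  · have := hq'.2 rfl
    have := hp'.2.1 rfl
    simp [projVertex] at hpq ⊢
    refine ⟨0, rfl, ?_, ?_, ?_⟩ <;> simp [goldenExchange, exchange] <;> linarith
  · have := hq'.2 rfl
    have := hp'.2.2 rfl hy
    simp [projVertex] at hpq
    linarith

/-- Every point of an exchanged interval lies on a chord pair with the corresponding sides. -/
lemma exists_points (h : IsSector u x y) {l : Fin 4} {z : ℝ} (h1 : (goldenExchange x y).lo l < z)
    (h2 : z < (goldenExchange x y).hi l) :
    ∃ e ∈ side (letterPair l).1, ∃ o ∈ side (letterPair l).2,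
      proj u e = z ∧ proj u o = proj u (shift (letterPair l).1 - e) := by
  have e1 := h.mul_add_eq
  have e2 := h.add_eq
  have e3 := h.left_nonneg
  have e4 := h.right_nonneg
  have e5 := h.mul_left_nonneg
  have e6 := h.mul_right_nonneg
  have key : ∀ i j : Fin 5, ((projVertex x y j < z ∧ z < projVertex x y (j + 1)) ∨
      (projVertex x y (j + 1) < z ∧ z < projVertex x y j)) →
      ((projVertex x y i < projVertex x y j + projVertex x y (j + 1) - z ∧
        projVertex x y j + projVertex x y (j + 1) - z < projVertex x y (i + 1)) ∨
      (projVertex x y (i + 1) < projVertex x y j + projVertex x y (j + 1) - z ∧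
        projVertex x y j + projVertex x y (j + 1) - z < projVertex x y i)) →
      ∃ e ∈ side j, ∃ o ∈ side i, proj u e = z ∧ proj u o = proj u (shift j - e) := by
    intro i j hj hi
    obtain ⟨e, he, rfl⟩ := h.exists_mem_side hj
    obtain ⟨o, ho, ho'⟩ := h.exists_mem_side hi
    exact ⟨e, he, o, ho, rfl, by rw [ho', map_sub, h.proj_shift]⟩
  -- Counterclockwise, upper sides run from right to left and lower sides from left to right.
  apply key
  · fin_cases l <;> simp [goldenExchange, exchange, letterPair, projVertex] at h1 h2 ⊢ <;>
    · right
      constructor <;> linarith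
  · fin_cases l <;> simp [goldenExchange, exchange, letterPair, projVertex] at h1 h2 ⊢ <;>
    · left
      constructor <;> linarith

lemma t_eq (h : IsSector u x y) (l : Fin 4) : (goldenExchange x y).t l =
    proj u (shift (letterPair l).2) - proj u (shift (letterPair l).1) := by
  have e1 := h.mul_add_eq
  have e2 := h.add_eq
  rw [h.proj_shift, h.proj_shift]
  fin_cases l <;> simp [goldenExchange, exchange, letterPair, projVertex] <;> linarith

lemma letterPair_fst (l : Fin 4) : (letterPair l).1 = 3 ∨ (letterPair l).1 = 4 := by
  revert l; decide

lemma letterPair_snd (l : Fin 4) :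
    (letterPair l).2 = 0 ∨ (letterPair l).2 = 1 ∨ (letterPair l).2 = 2 := by
  revert l; decide

lemma letterPair_fst_ne_snd (l l' : Fin 4) : (letterPair l).1 ≠ (letterPair l').2 := by
  revert l l'; decide

/-- An orbit of the interval exchange comes from a trajectory. -/
lemma exists_trajectory (h : IsSector u x y) {v : ℤ → Fin 4} {X : ℤ → ℝ}
    (ho : (goldenExchange x y).IsOrbit v X) :
    ∃ τ : Trajectory (u, Real.sin (Real.pi / 5)), ∀ m, τ.word m = letterPair (v m) := by
  choose e he o hoo hX hproj using fun m => h.exists_points (ho.lo_lt m) (ho.lt_hi m)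
  have hdiv : ∀ m : ℤ, (2 * m + 1) / 2 = m := fun m => by omega
  have hdiv' : ∀ m : ℤ, (2 * m) / 2 = m := fun m => by omega
  -- Crossings 2m and 2m + 1 belong to the m-th letter; the odd ones lie on P' = -P, hence the sign.
  refine ⟨⟨fun n => if Even n then (letterPair (v (n / 2))).1 else (letterPair (v (n / 2))).2,
    fun n => if Even n then e (n / 2) else -o (n / 2), ?_, ?_, ?_⟩, ?_⟩
  · intro n
    by_cases hn : Even n
    · simpa [hn, sgn_even hn] using he (n / 2)
    · simpa [hn, sgn_odd hn] using hoo (n / 2)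
  · intro n
    rcases Int.even_or_odd' n with ⟨m, rfl | rfl⟩
    · have h0 : Even (2 * m) := even_two_mul m
      have h1 : ¬ Even (2 * m + 1) := by simp
      simp only [h0, h1, if_true, if_false, hdiv, hdiv', sgn_even h0, one_smul]
      obtain ⟨t, ht, heq⟩ := exists_chord (letterPair_snd _) (letterPair_fst _) (hoo m)
        (shift_sub_mem_side (he m)) (hproj m)
      refine ⟨t, ht, ?_⟩
      rw [sub_eq_iff_eq_add] at heq
      rw [heq]
      abel
    · have h0 : Even (2 * m + 1 + 1) := ⟨m + 1, by ring⟩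
      have h1 : ¬ Even (2 * m + 1) := by simp
      have h2 : (2 * m + 1 + 1) / 2 = m + 1 := by omega
      simp only [h0, h1, if_true, if_false, hdiv, h2, sgn_odd h1, neg_smul, one_smul]
      -- The half-turns at the two crossed sides project to reflections of the line, and their
      -- composition is the translation of the exchanged interval.
      obtain ⟨t, ht, heq⟩ := exists_chord (u := u) (letterPair_snd _) (letterPair_fst _)
        (shift_sub_mem_side (hoo m)) (he (m + 1)) (by
          rw [hX, ho.step, h.t_eq, map_sub, hproj, map_sub, hX]
          ring)
      refine ⟨t, ht, ?_⟩
      rw [heq]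
      abel
  · intro n
    by_cases hn : Even n
    · have hn' : ¬ Even (n + 1) := by simpa [Int.even_add_one] using hn
      simpa [hn, hn'] using (letterPair_fst_ne_snd _ _).symm
    · have hn' : Even (n + 1) := by simpa [Int.even_add_one] using hn
      simpa [hn, hn'] using letterPair_fst_ne_snd _ _
  · intro m
    have h1 : ¬ Even (2 * m + 1) := by simp
    simp [Trajectory.word, h1, hdiv]

/-- A trajectory gives an orbit of the interval exchange, and is closed if the orbit is periodic. -/
lemma exists_isOrbit (h : IsSector u x y) (ρ : Trajectory (u, Real.sin (Real.pi / 5))) :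
    ∃ v X, (goldenExchange x y).IsOrbit v X ∧ (∀ m, ρ.word m = letterPair (v m)) ∧
      ∀ N : ℕ, 0 < N → Function.Periodic v N → Function.Periodic X N → ρ.IsClosed := by
  have odd : ∀ m : ℤ, ¬ Even (2 * m + 1) := fun m => by simp
  have he : ∀ m, ρ.pt (2 * m) ∈ side (ρ.label (2 * m)) := fun m => by
    simpa [sgn_even (even_two_mul m)] using ρ.pt_mem (2 * m)
  have hoo : ∀ m, -ρ.pt (2 * m + 1) ∈ side (ρ.label (2 * m + 1)) := fun m => by
    simpa [sgn_odd (odd m)] using ρ.pt_mem (2 * m + 1)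
  have hchord : ∀ m, ∃ t : ℝ, 0 < t ∧ shift (ρ.label (2 * m)) - ρ.pt (2 * m) =
      -ρ.pt (2 * m + 1) + t • (u, Real.sin (Real.pi / 5)) := fun m => by
    obtain ⟨t, ht, heq⟩ := ρ.step (2 * m)
    refine ⟨t, ht, ?_⟩
    rw [heq, sgn_even (even_two_mul m), one_smul]
    abel
  have hslope : ∀ m, 0 < slope x y (ρ.label (2 * m + 1)) ∧ slope x y (ρ.label (2 * m)) < 0 :=
    fun m => by
      obtain ⟨t, ht, heq⟩ := hchord m
      exact h.slope_of_chord (hoo m) (shift_sub_mem_side (he m)) (ρ.label_ne (2 * m)) ht heq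
  have hproj : ∀ m, proj u (-ρ.pt (2 * m + 1)) =
      proj u (shift (ρ.label (2 * m)) - ρ.pt (2 * m)) := fun m => by
    obtain ⟨t, ht, heq⟩ := hchord m
    rw [heq, map_add, proj_direction, add_zero]
  choose v hv hlo hhi ht using fun m =>
    h.exists_letter (hoo m) (he m) (hslope m).1 (hslope m).2 (hproj m)
  refine ⟨v, fun m => proj u (ρ.pt (2 * m)), ⟨hlo, hhi, fun m => ?_⟩, fun m => (hv m).symm, ?_⟩
  · obtain ⟨t, _, heq⟩ := ρ.step (2 * m + 1)
    have hm := hproj m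
    rw [map_neg, map_sub] at hm
    rw [show 2 * (m + 1) = 2 * m + 1 + 1 by ring, heq, sgn_odd (odd m), map_add, proj_direction,
      map_sub, neg_smul, one_smul, map_neg, ht]
    linarith
  · intro N hN hvN hXN
    have hlabel : ∀ m, ρ.label (2 * (m + N)) = ρ.label (2 * m) ∧
        ρ.label (2 * (m + N) + 1) = ρ.label (2 * m + 1) := fun m => by
      have h1 := hv (m + N)
      rw [hvN, hv m] at h1
      exact ⟨(congrArg Prod.fst h1).symm, (congrArg Prod.snd h1).symm⟩
    refine ⟨N, hN, fun n => ?_⟩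
    rcases Int.even_or_odd' n with ⟨m, rfl | rfl⟩
    · rw [← mul_add]
      refine ⟨(hlabel m).1, ?_⟩
      have h1 := he (m + N)
      rw [(hlabel m).1] at h1
      exact h.eq_of_mem_side h1 (he m) (hslope m).2.ne (hXN m)
    · rw [add_right_comm, ← mul_add]
      refine ⟨(hlabel m).2, ?_⟩
      have h1 := hoo (m + N)
      rw [(hlabel m).2] at h1
      refine neg_injective (h.eq_of_mem_side h1 (hoo m) (hslope m).1.ne' ?_)
      rw [hproj, hproj, map_sub, map_sub, (hlabel m).1]
      exact congrArg _ (hXN m)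

end IsSector

/-! ### From strips of the exchange to strips of trajectories -/

lemma hasPeriod_of_isLeast {d : ℝ × ℝ} {τ : Trajectory d} {g : ℤ → Fin 4} {a : ℕ}
    (hτ : ∀ m, τ.word m = letterPair (g m))
    (hg : IsLeast {r : ℕ | 0 < r ∧ ∀ m : ℤ, g (m + r) = g m} a) : τ.HasPeriod a := by
  unfold Trajectory.HasPeriod
  simpa only [hτ, letterPair_injective.eq_iff] using hg

lemma div_add_mul_eq {f a b : ℝ} (hf : f * f = f + 1) (hf0 : f ≠ 0) (h : a + b ≠ 0) :
    (f - 1) / (a + b) * a = (f - 1) / 2 + f * ((a - b) / (2 * f ^ 2 * (a + b))) := by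
  field_simp
  linear_combination (a - b) * hf

/-- The sector parameters of the direction with given indices. -/
lemma isSector_ray {k : ℕ} (n : Fin k → Fin 4) :
    IsSector ((ray n 0 - ray n 1) / (2 * φ ^ 2 * (ray n 0 + ray n 1)))
      ((φ - 1) / (ray n 0 + ray n 1) * ray n 0) ((φ - 1) / (ray n 0 + ray n 1) * ray n 1) := by
  obtain ⟨h0, h1⟩ := ray_nonneg n
  have h2 : 0 < φ - 1 := sub_pos.2 Real.one_lt_goldenRatio
  have hs : ray n 0 + ray n 1 ≠ 0 := by positivity
  have hφ := goldenRatio_mul_self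
  have hφ0 := Real.goldenRatio_ne_zero
  refine ⟨by positivity, by positivity, div_add_mul_eq hφ hφ0 hs, ?_⟩
  rw [add_comm] at hs ⊢
  rw [div_add_mul_eq hφ hφ0 hs, ← neg_sub (ray n 0), neg_div]
  ring

/-- The periods of the strips of a direction with given indices. -/
theorem exists_isPeriodPair {k : ℕ} (n : Fin k → Fin 4) :
    ∃ a A : ℕ, IsPeriodPair (direction (alpha n)) a A ∧
      (a : ℝ) + φ * (A : ℝ) =
        ((List.ofFn fun i => X (n i)).reverse.prod *ᵥ ![φ ^ 2, φ ^ 2]) 0 := by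
  obtain ⟨h0, h1⟩ := ray_nonneg n
  have hw : 0 < (φ - 1) / (ray n 0 + ray n 1) :=
    div_pos (sub_pos.2 Real.one_lt_goldenRatio) (by positivity)
  have hsec := isSector_ray n
  obtain ⟨a, A, g₁, g₂, q₁, q₂, hs₁, hs₂, hg₁, hg₂, hne, hcover, haA, hsum⟩ :=
    exists_isStrip n hw
  have hsep := goldenExchange_separated hsec.left_nonneg hsec.right_nonneg
  obtain ⟨σ, hσ⟩ := hsec.exists_trajectory (hs₁.isOrbit hw)
  obtain ⟨τ, hτ⟩ := hsec.exists_trajectory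
    (hs₂.isOrbit (mul_pos Real.goldenRatio_pos hw))
  refine ⟨a, A, ?_, ?_⟩
  · rw [direction_alpha]
    refine ⟨haA, fun ρ => ?_, σ, τ, hasPeriod_of_isLeast hσ hg₁, hasPeriod_of_isLeast hτ hg₂, ?_,
      fun ρ => ?_⟩
    · obtain ⟨v, x, hx, -, hcl⟩ := hsec.exists_isOrbit ρ
      rcases hx.eq_or_eq hsep hs₁ hs₂ hcover with ⟨hv, hx, -⟩ | ⟨hv, hx, -⟩
      · exact hcl a hs₁.pos hv hx
      · exact hcl A hs₂.pos hv hx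
    · rintro ⟨j, hj⟩
      exact hne ⟨j, fun m => letterPair_injective (by rw [← hσ, ← hτ, hj])⟩
    · obtain ⟨v, x, hx, hv, -⟩ := hsec.exists_isOrbit ρ
      refine (hx.eq_or_eq hsep hs₁ hs₂ hcover).imp ?_ ?_
      · rintro ⟨-, -, j, hj⟩
        exact ⟨j, fun m => by rw [hv, hσ, hj]⟩
      · rintro ⟨-, -, j, hj⟩
        exact ⟨j, fun m => by rw [hv, hτ, hj]⟩
  · rw [hsum]
    simp [ray, Matrix.vecMul, Matrix.mulVec, dotProduct, Fin.sum_univ_two]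
    ring

end DoublePentagon

end

theorem theorem4 (k : ℕ) (n : Fin k → Fin 4)
    (hn : ∀ i : Fin k, (i : ℕ) + 1 = k → n i ≠ 0) :
    ∃ a A : ℕ,
      DoublePentagon.IsPeriodPair (DoublePentagon.direction (DoublePentagon.alpha n)) a A ∧
      (a : ℝ) + φ * (A : ℝ) =
        ((List.ofFn fun i => DoublePentagon.X (n i)).reverse.prod *ᵥ ![φ ^ 2, φ ^ 2]) 0 := by
  exact DoublePentagon.exists_isPeriodPair n
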